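/- Let $X$ be a finite regular CW complex (each attaching map is a homeomorphism onto its image), with the face order on its cells: $x\le y$ iff the closed cell $x$ is contained in the closed cell $y$. Let $f$ be a discrete Morse function on $X$: a real-valued function on the cells such that every $k$-cell $x$ has at most one $(k+1)$-cell $y\supseteq x$ with $f(x)\ge f(y)$ and at most one $(k-1)$-cell $y\subseteq x$ with $f(y)\ge f(x)$; $x$ is critical if there is no cell of either kind. A regular pair is a set $\{x,y\}$ with $x\subseteq y$, $\dim y=\dim x+1$ and $f(x)\ge f(y)$. *Entrance path category.* $\mathrm{Ent}[X]$ has the cells as objects; its morphisms $x\to y$ are the strictly descending sequences $(x=x_0>x_1>\dots>x_k=y)$ (with $r:=k$), composed by concatenation and partially ordered by $g\Rightarrow g'$ iff $g$ is a subsequence of $g'$. Let $\Sigma$ be the set of morphisms $(y>x)$ with $\{x,y\}$ a regular pair, and $\Sigma^+$ its union with all identities. *Discrete flow category.* For critical cells $w,z$, the elements of $\mathrm{Hom}(w,z)$ are the classes of zigzags $$w=x_0\xrightarrow{g_0}y_0\xleftarrow{f_0}x_1\xrightarrow{g_1}\cdots\xleftarrow{f_{k-1}}x_k\xrightarrow{g_k}y_k=z,\qquad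 f_i\in\Sigma^+,\ g_i \text{ any morphism of } \mathrm{Ent}[X],$$ under the equivalence relation generated by (horizontal) deleting an intermediate identity, i.e. replacing $x_i\xrightarrow{g_i}y_i\xleftarrow{\mathrm{id}}y_i\xrightarrow{g_{i+1}}y_{i+1}$ by $x_i\xrightarrow{g_{i+1}\circ g_i}y_{i+1}$, and (vertical) relating two zigzags of the same length that are the rows of a commutative diagram whose vertical maps $u_i\colon y_i\to y_i'$, $v_i\colon x_i\to x_i'$ lie in $\Sigma^+$, with $v_0=\mathrm{id}_w$, $u_k=\mathrm{id}_z$. One puts $[\gamma']\Rightarrow[\gamma]$ iff there are representatives of $[\gamma]$ (unprimed, top row) and $[\gamma']$ (primed, bottom row) and such vertical maps in $\Sigma^+$ with $g_i'\circ v_i\Rightarrow u_i\circ g_i$ and $f_i'\circ v_{i+1}\Rightarrow u_i\circ f_i$ for all $i$. *Rank and covering.* Let $P_{w,z}$ be the opposite of the poset $\mathrm{Hom}(w,z)$ with a least element $\hat 0$ added, and let $\rho(\hat 0)=-1$ and $\rho([\gamma])=\dim w-\dim z+\sum_i r(f_i)-\sum_i r(g_i)$ for any zigzag representing $[\gamma]$.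 "Covers" refers to $P_{w,z}$: $[\tau]$ covers $[\gamma]$ iff $[\tau]\ne[\gamma]$, $[\tau]\Rightarrow[\gamma]$, and no morphism lies strictly between them. *Sequence representation.* A sequence representation of $[\gamma]\in\mathrm{Hom}(w,z)$ is a sequence $(w=x_0,\dots,x_k=z)$ of pairwise distinct cells such that for all $i<k$ either $x_{i+1}<x_i$ or $\{x_i,x_{i+1}\}$ is a regular pair, and which is the concatenation of the sequences $g_0,g_1,\dots$ of some zigzag representing $[\gamma]$. **Theorem.** Every morphism in $\mathrm{Hom}(w,z)$ has exactly one sequence representation. Let $[\gamma],[\tau]\in\mathrm{Hom}(w,z)$ with $\rho([\tau])=\rho([\gamma])+1$. Then $[\tau]$ covers $[\gamma]$ if and only if the sequence representation of $[\gamma]$ equals the sequence representation of $[\tau]$ with exactly one element added or exactly one element removed. -/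

import Mathlib

universe v u

namespace DiscreteFlow

open CategoryTheory

/-! ### p-categories -/

/-- A p-category: a category enriched in posets.  For morphisms, `f ≤ f'` is written
`f ⇒ f'` in the literature. -/
class PCategory (C : Type u) extends Category.{v} C where
  homOrder : ∀ x y : C, PartialOrder (x ⟶ y)
  comp_le_comp : ∀ {x y z : C} {f f' : x ⟶ y} {g g' : y ⟶ z},
    f ≤ f' → g ≤ g' → f ≫ g ≤ f' ≫ g'

attribute [reducible, instance] PCategory.homOrder

/-! ### The localization of a p-category -/

section Localization

variable {C : Type u} [PCategory.{v} C]

/-- The union of `S` with all identities. -/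
inductive Plus (S : MorphismProperty C) : ∀ ⦃x y : C⦄, (x ⟶ y) → Prop
  | of {x y : C} (f : x ⟶ y) (hf : S f) : Plus S f
  | id (x : C) : Plus S (𝟙 x)

/-- Zigzags `w --g₀--> y₀ <--f₀-- x₁ --g₁--> y₁ <-- ⋯ <-- x_k --g_k--> z`, where the left-pointing
arrows `fᵢ` are in `S` or identities and the right-pointing arrows `gᵢ` are arbitrary. -/
inductive Zigzag (S : MorphismProperty C) : C → C → Type (max u v)
  | single {x z : C} (g : x ⟶ z) : Zigzag S x z
  | cons {x y x' z : C} (g : x ⟶ y) (f : x' ⟶ y) (hf : Plus S f) (ζ : Zigzag S x' z) : Zigzag S x z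

variable {S : MorphismProperty C}

/-- Precompose the first right-pointing arrow of a zigzag with a morphism. -/
def Zigzag.precomp {x y z : C} (g : x ⟶ y) : Zigzag S y z → Zigzag S x z
  | .single g' => .single (g ≫ g')
  | .cons g' f hf ζ => .cons (g ≫ g') f hf ζ

/-- The second zigzag results from the first one by removing one intermediate identity:
`x --g--> y <--id-- y --g'--> y'` is replaced by `x --(g' ∘ g)--> y'`. -/
inductive Horizontal : ∀ {x z : C}, Zigzag S x z → Zigzag S x z → Prop
  | remove {x y z : C} (g : x ⟶ y) (ζ : Zigzag S y z) :
      Horizontal (.cons g (𝟙 y) (.id y) ζ) (ζ.precomp g)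
  | cons {x y x' z : C} (g : x ⟶ y) (f : x' ⟶ y) (hf : Plus S f) {ζ ζ' : Zigzag S x' z}
      (h : Horizontal ζ ζ') : Horizontal (.cons g f hf ζ) (.cons g f hf ζ')

/-- `Ladder R v ζ ζ'`: the zigzags `ζ : x ⇝ z` and `ζ' : x' ⇝ z` (of the same length) are the top
and the bottom row of a diagram whose vertical arrows (pointing down) are in `S` or identities,
the first one being `v : x ⟶ x'` and the last one the identity of `z`, such that in each square the
composite through the lower left corner is `R`-related to the composite through the upper right
corner (right-pointing squares), and similarly for the squares of left-pointing arrows. -/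
inductive Ladder (R : HomRel C) :
    ∀ {x x' z : C}, (x ⟶ x') → Zigzag S x z → Zigzag S x' z → Prop
  | single {x x' z : C} (v : x ⟶ x') (hv : Plus S v) (g : x ⟶ z) (g' : x' ⟶ z)
      (h : R (v ≫ g') g) : Ladder R v (.single g) (.single g')
  | cons {x x' y y' x₁ x₁' z : C} (v : x ⟶ x') (hv : Plus S v) (u : y ⟶ y') (hu : Plus S u)
      (v₁ : x₁ ⟶ x₁') (g : x ⟶ y) (g' : x' ⟶ y')
      (f : x₁ ⟶ y) (hf : Plus S f) (f' : x₁' ⟶ y') (hf' : Plus S f')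
      (ζ : Zigzag S x₁ z) (ζ' : Zigzag S x₁' z)
      (hg : R (v ≫ g') (g ≫ u)) (hR : R (v₁ ≫ f') (f ≫ u)) (h : Ladder R v₁ ζ ζ') :
      Ladder R v (.cons g f hf ζ) (.cons g' f' hf' ζ')

/-- Two zigzags are vertically related if they are the rows of a commutative diagram. -/
def Vertical {x z : C} (ζ ζ' : Zigzag S x z) : Prop :=
  Ladder (fun _ _ a b => a = b) (𝟙 x) ζ ζ'

variable (S) in
/-- Morphisms of the localization of `C` at `S`: zigzags modulo the equivalence relation generated
by the horizontal and the vertical relation. -/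
def LocHom (w z : C) : Type (max u v) :=
  Quot fun ζ ζ' : Zigzag S w z => Horizontal ζ ζ' ∨ Vertical ζ ζ'

/-- The class of a zigzag. -/
def LocHom.mk {w z : C} (ζ : Zigzag S w z) : LocHom S w z := Quot.mk _ ζ

/-- `γ' ⇒ γ` if representatives of `γ` and `γ'` fit into the top and the bottom row of a ladder with
a 2-cell (from the composite through the lower left corner) in each square. -/
instance {w z : C} : LE (LocHom S w z) where
  le γ' γ := ∃ ζ ζ' : Zigzag S w z, LocHom.mk ζ = γ ∧ LocHom.mk ζ' = γ' ∧
    Ladder (fun _ _ a b => a ≤ b) (𝟙 w) ζ ζ'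

instance {w z : C} : LT (LocHom S w z) where
  lt γ' γ := γ' ≤ γ ∧ γ' ≠ γ

end Localization

/-! ### The entrance path category -/

/-- A strictly descending sequence `x = x₀ > x₁ > ⋯ > x_k = y`, stored as `x` and the list
`tail = [x₁, …, x_k]`. -/
@[ext]
structure EntrancePath {P : Type u} [PartialOrder P] (x y : P) where
  tail : List P
  descending : (x :: tail).IsChain (· > ·)
  getLast_eq : (x :: tail).getLast (List.cons_ne_nil _ _) = y

namespace EntrancePath

variable {P : Type u} [PartialOrder P]

/-- The whole sequence `[x₀, x₁, …, x_k]`. -/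
def seq {x y : P} (f : EntrancePath x y) : List P := x :: f.tail

/-- The number `k` of steps of `x₀ > x₁ > ⋯ > x_k`. -/
def r {x y : P} (f : EntrancePath x y) : ℕ := f.tail.length

/-- The one-element sequence `(x)`. -/
def id (x : P) : EntrancePath x x := ⟨[], by simp, by simp⟩

/-- Concatenation of `x > ⋯ > y` and `y > ⋯ > z`. -/
def comp {x y z : P} (f : EntrancePath x y) (g : EntrancePath y z) : EntrancePath x z where
  tail := f.tail ++ g.tail
  descending := by
    have hg := g.descending
    have hf := f.getLast_eq
    rw [← List.cons_append, List.isChain_append]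
    refine ⟨f.descending, ?_, ?_⟩
    · rw [List.isChain_cons] at hg
      exact hg.2
    · intro a ha b hb
      rw [List.getLast?_eq_getLast_of_ne_nil (List.cons_ne_nil _ _), hf] at ha
      rw [List.isChain_cons] at hg
      simp only [Option.mem_def, Option.some.injEq] at ha
      subst ha
      exact hg.1 b hb
  getLast_eq := by
    have hg := g.getLast_eq
    have hf := f.getLast_eq
    rcases h : g.tail with _ | ⟨b, l⟩
    · simp only [h, List.getLast_singleton] at hg
      simp only [List.append_nil]
      rw [hf, hg]
    · simp only [h, List.getLast_cons_cons] at hg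
      simp only [← List.cons_append]
      rw [List.getLast_append_of_right_ne_nil _ _ (List.cons_ne_nil _ _)]
      exact hg

end EntrancePath

/-- The objects of the entrance path category of a poset `P` (for a regular CW complex: of its face
poset) are the elements of `P`. -/
def Ent (P : Type u) : Type u := P

/-- An element of `P` as an object of the entrance path category. -/
def Ent.of {P : Type u} (x : P) : Ent P := x

/-- The entrance path category: morphisms are strictly descending sequences, composition is
concatenation, and `f ⇒ f'` if and only if `f` is a subsequence of `f'`. -/
instance {P : Type u} [PartialOrder P] : PCategory (Ent P) where
  Hom x y := EntrancePath (P := P) x y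
  id x := EntrancePath.id (P := P) x
  comp f g := EntrancePath.comp f g
  id_comp f := by ext1; simp [EntrancePath.comp, EntrancePath.id]
  comp_id f := by ext1; simp [EntrancePath.comp, EntrancePath.id]
  assoc f g h := by ext1; simp [EntrancePath.comp]
  homOrder x y :=
    { le := fun f f' => f.seq.Sublist f'.seq
      le_refl := fun f => List.Sublist.refl _
      le_trans := fun _ _ _ h h' => List.Sublist.trans h h'
      le_antisymm := fun f f' h h' => by
        have := h.antisymm h'
        ext1
        exact (List.cons.inj this).2 }
  comp_le_comp := fun {x y z f f' g g'} h h' => by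
    change (x :: (f.tail ++ g.tail)).Sublist (x :: (f'.tail ++ g'.tail))
    have h1 : f.tail.Sublist f'.tail := List.cons_sublist_cons.1 h
    have h2 : g.tail.Sublist g'.tail := List.cons_sublist_cons.1 h'
    exact List.cons_sublist_cons.2 (h1.append h2)

section Rank

variable {P : Type u} [PartialOrder P] {S : MorphismProperty (Ent P)}

/-- The sequence obtained by concatenating the right-pointing arrows of a zigzag:
`(w = x₀ > ⋯ > y₀) (x₁ > ⋯ > y₁) ⋯ (x_k > ⋯ > y_k = z)`. -/
def Zigzag.toSeq {x z : Ent P} : Zigzag S x z → List P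
  | .single g => EntrancePath.seq g
  | .cons g _ _ ζ => EntrancePath.seq g ++ ζ.toSeq

/-- `∑ r(fᵢ) - ∑ r(gᵢ)` for a zigzag with left-pointing arrows `fᵢ` and right-pointing
arrows `gᵢ`. -/
def Zigzag.rankSum {x z : Ent P} : Zigzag S x z → ℤ
  | .single g => -(EntrancePath.r g : ℤ)
  | .cons g f _ ζ => (EntrancePath.r f : ℤ) - (EntrancePath.r g : ℤ) + ζ.rankSum

theorem r_comp {x y z : Ent P} (f : x ⟶ y) (g : y ⟶ z) :
    EntrancePath.r (f ≫ g) = EntrancePath.r f + EntrancePath.r g :=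
  List.length_append

theorem r_id (x : Ent P) : EntrancePath.r (𝟙 x) = 0 := rfl

theorem rankSum_precomp {x y z : Ent P} (g : x ⟶ y) (ζ : Zigzag S y z) :
    (ζ.precomp g).rankSum = ζ.rankSum - EntrancePath.r g := by
  cases ζ <;> simp only [Zigzag.precomp, Zigzag.rankSum, r_comp] <;> push_cast <;> ring

theorem rankSum_horizontal {x z : Ent P} {ζ ζ' : Zigzag S x z} (h : Horizontal ζ ζ') :
    ζ.rankSum = ζ'.rankSum := by
  induction h with
  | remove g ζ =>
    rw [rankSum_precomp]
    simp only [Zigzag.rankSum, r_id]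
    push_cast
    ring
  | cons g f hf h ih => simp only [Zigzag.rankSum, ih]

theorem rankSum_ladder {x x' z : Ent P} {v : x ⟶ x'} {ζ : Zigzag S x z} {ζ' : Zigzag S x' z}
    (h : Ladder (fun _ _ a b => a = b) v ζ ζ') :
    ζ'.rankSum = ζ.rankSum + EntrancePath.r v := by
  induction h with
  | single v hv g g' h =>
    simp only [Zigzag.rankSum, ← h, r_comp]
    push_cast
    ring
  | cons v hv u hu v₁ g g' f hf f' hf' ζ ζ' hg hR h ih =>
    have h1 := congrArg EntrancePath.r hg
    have h2 := congrArg EntrancePath.r hR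
    rw [r_comp, r_comp] at h1 h2
    simp only [Zigzag.rankSum, ih]
    omega

/-- `∑ r(fᵢ) - ∑ r(gᵢ)` for any representative of a morphism of the localization. -/
def LocHom.rankSum {w z : Ent P} (γ : LocHom S w z) : ℤ :=
  Quot.lift Zigzag.rankSum (by
    rintro ζ ζ' (h | h)
    · exact rankSum_horizontal h
    · have := rankSum_ladder h
      rw [r_id] at this
      simpa using this.symm) γ

end Rank

/-! ### Regular CW complexes and discrete Morse functions -/

open Topology

/-- A CW complex is regular if each attaching map (the restriction of the characteristic map to the
boundary sphere) is a homeomorphism onto its image. -/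
def IsRegularCW {X : Type u} [TopologicalSpace X] (K : Set X) [CWComplex K] : Prop :=
  ∀ (n : ℕ) (e : RelCWComplex.cell K n), Topology.IsEmbedding
    ((Metric.sphere (0 : Fin n → ℝ) 1).domRestrict (RelCWComplex.map (C := K) n e))

/-- The cells of a CW complex, of all dimensions. -/
structure Cell {X : Type u} [TopologicalSpace X] (K : Set X) [CWComplex K] where
  dim : ℕ
  idx : RelCWComplex.cell K dim

section Morse

variable {X : Type u} [TopologicalSpace X] {K : Set X} [CWComplex K]

/-- The closed cell as a subset of the space. -/
def Cell.closed (x : Cell K) : Set X := RelCWComplex.closedCell (C := K) x.dim x.idx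

theorem Cell.dim_lt_of_closed_subset {x y : Cell K} (h : x.closed ⊆ y.closed) (hne : x ≠ y) :
    x.dim < y.dim := by
  have hx : RelCWComplex.map (C := K) x.dim x.idx 0 ∈ RelCWComplex.openCell (C := K) x.dim x.idx :=
    RelCWComplex.map_zero_mem_openCell _ _
  have hy := h (RelCWComplex.openCell_subset_closedCell _ _ hx)
  rw [Cell.closed, ← RelCWComplex.cellFrontier_union_openCell_eq_closedCell] at hy
  rcases hy with hy | hy
  · obtain ⟨I, hI⟩ := CWComplex.cellFrontier_subset_finite_openCell (C := K) y.dim y.idx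
    have hm := hI hy
    simp only [Set.mem_iUnion] at hm
    obtain ⟨m, hm, j, -, hj⟩ := hm
    have := RelCWComplex.eq_of_not_disjoint_openCell (C := K) (j := x.idx) (i := j)
      (Set.not_disjoint_iff.2 ⟨_, hx, hj⟩)
    have hd := congrArg Sigma.fst this
    simp only at hd
    omega
  · have := RelCWComplex.eq_of_not_disjoint_openCell (C := K) (j := x.idx) (i := y.idx)
      (Set.not_disjoint_iff.2 ⟨_, hx, hy⟩)
    exfalso
    apply hne
    cases x
    cases y
    simp only [Sigma.mk.injEq] at this
    obtain ⟨rfl, h⟩ := this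
    cases h
    rfl

/-- The face poset: `x ≤ y` if the closed cell `x` is contained in the closed cell `y`. -/
instance : PartialOrder (Cell K) where
  le x y := x.closed ⊆ y.closed
  le_refl _ := Set.Subset.rfl
  le_trans _ _ _ h h' := Set.Subset.trans h h'
  le_antisymm x y h h' := by
    by_contra hne
    have h1 := Cell.dim_lt_of_closed_subset h hne
    have h2 := Cell.dim_lt_of_closed_subset h' (Ne.symm hne)
    omega

/-- `{x, y}` is a regular pair of `f`, where `x` is the lower-dimensional cell. -/
def IsRegularPair (f : Cell K → ℝ) (x y : Cell K) : Prop :=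
  y.dim = x.dim + 1 ∧ x ≤ y ∧ f y ≤ f x

/-- `f` is a discrete Morse function: for each `k`-cell `x` there is at most one `(k+1)`-cell
`y ⊇ x` with `f x ≥ f y`, and at most one `(k-1)`-cell `y ⊆ x` with `f y ≥ f x`. -/
def IsDiscreteMorse (f : Cell K → ℝ) : Prop :=
  ∀ x : Cell K,
    {y : Cell K | y.dim = x.dim + 1 ∧ x ≤ y ∧ f y ≤ f x}.Subsingleton ∧
    {y : Cell K | x.dim = y.dim + 1 ∧ y ≤ x ∧ f x ≤ f y}.Subsingleton

/-- `x` is critical: there is neither a `(k+1)`-cell `y ⊇ x` with `f x ≥ f y` nor a `(k-1)`-cell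
`y ⊆ x` with `f y ≥ f x`. -/
def IsCritical (f : Cell K → ℝ) (x : Cell K) : Prop :=
  (¬ ∃ y : Cell K, y.dim = x.dim + 1 ∧ x ≤ y ∧ f y ≤ f x) ∧
  (¬ ∃ y : Cell K, x.dim = y.dim + 1 ∧ y ≤ x ∧ f x ≤ f y)

/-- The Morse system induced by `f`: the two-element sequences `(y > x)` with `{x, y}` a regular
pair. -/
def morseSystem (f : Cell K → ℝ) : MorphismProperty (Ent (Cell K)) :=
  fun y x g => IsRegularPair f x y ∧ EntrancePath.seq g = [y, x]

/-- The objects of the discrete flow category. -/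
abbrev CriticalCell (f : Cell K → ℝ) : Type u := {x : Cell K // IsCritical f x}

/-- The Hom posets of the discrete flow category, the full subcategory of the localization of the
entrance path category at the Morse system on the critical cells. -/
abbrev FlowHom (f : Cell K → ℝ) (w z : CriticalCell f) : Type u :=
  LocHom (morseSystem f) (Ent.of w.1) (Ent.of z.1)

/-- The opposite of `Hom(w, z)`, augmented with a least element. -/
abbrev AugHomOp (f : Cell K → ℝ) (w z : CriticalCell f) : Type u :=
  WithBot (FlowHom f w z)ᵒᵈ

/-- A morphism as an element of the augmented opposite of the Hom poset. -/
def toAug {f : Cell K → ℝ} {w z : CriticalCell f} (γ : FlowHom f w z) : AugHomOp f w z :=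
  WithBot.some (OrderDual.toDual γ)

/-- The rank function: `-1` at the least element, and
`(dim w - dim z) + ∑ r(fᵢ) - ∑ r(gᵢ)` at the class of a zigzag with left-pointing arrows `fᵢ` and
right-pointing arrows `gᵢ`. -/
def rho {f : Cell K → ℝ} {w z : CriticalCell f} (p : AugHomOp f w z) : ℤ :=
  WithBot.recBotCoe (-1)
    (fun γ => ((w.1.dim : ℤ) - (z.1.dim : ℤ)) + (OrderDual.ofDual γ).rankSum) p

/-- `s` is a sequence representation of `γ`: it is a sequence of distinct cells from `w` to `z` in
which each step goes to a proper face or along a regular pair, and it is the concatenation of the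
right-pointing arrows of a zigzag that represents `γ`. -/
def IsSeqRep {f : Cell K → ℝ} {w z : CriticalCell f} (γ : FlowHom f w z) (s : List (Cell K)) :
    Prop :=
  s.Nodup ∧ s.head? = some w.1 ∧ s.getLast? = some z.1 ∧
  s.IsChain (fun a b => b < a ∨ IsRegularPair f a b ∨ IsRegularPair f b a) ∧
  ∃ ζ : Zigzag (morseSystem f) (Ent.of w.1) (Ent.of z.1), LocHom.mk ζ = γ ∧ ζ.toSeq = s

end Morse

/-- The list `t` is the list `s` with exactly one element added (at any position). -/
def AddsOne {α : Type u} (s t : List α) : Prop :=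
  ∃ (a b : List α) (x : α), s = a ++ b ∧ t = a ++ x :: b

end DiscreteFlow

/-! A zigzag is a walk through cells whose steps go down to a proper face or up along a regular
pair. Cancelling repetitions `a, a` and detours `a, b, a` leaves a reduced walk (`reduceWalk`).
Neither defining relation of the localization changes it, so it descends to classes (`LocHom.nf`).
It also determines the class: one of the two steps of a detour goes up, hence is a regular pair, and
the detour composes an arrow with its formal inverse (`LocHom.isWalk_nf`, `IsWalk.unique`).

A walk without repeated cells is reduced, so a sequence representation must be the normal form.
Conversely the normal form has no repeated cells: a potential is constant on regular pairs and
strictly drops on every other descent, so a walk returning to a cell would have to stay among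
regular pairs, which share no cells (`IsPotential.nodup`).

For covers, the left-pointing squares of a ladder of 2-cells commute strictly, because sequences
with at most one step cannot be refined. The rank difference thus counts the cells deleted in the
right-pointing squares. Difference zero forces equality, and difference one means that one cell is
deleted from one descending sequence (`IsCoverMatching.ladder_le`). Following this deletion through
the cancellations changes the normal form by exactly one cell (`OneStep.walkDiff`). Conversely,
walks differing in one inner cell are compared by a direct 2-cell (`IsWalk.le_of_insert`).

All of this needs regular pairs never to chain. That follows from a geometric fact: in a regular
complex a cell lying between a `k`-cell and a `(k+2)`-cell is never the only one
(`IsRegularCW.exists_ne_between`). It rests on invariance of domain, derived here from the absence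
of a smooth retraction onto the sphere. -/

namespace DiscreteFlow

section Topology

open MeasureTheory Metric Set Filter Topology Polynomial

/-! ### No-retraction theorem, Brouwer's theorem and invariance of domain -/

section NoRetraction

variable {E : Type*} [NormedAddCommGroup E] [InnerProductSpace ℝ E] [FiniteDimensional ℝ E]

/-- `det (1 + t A)` is a polynomial in `t` of degree at most `finrank E`. -/
theorem exists_polynomial_eval_eq_det_one_add_smul (A : E →L[ℝ] E) :
    ∃ p : ℝ[X], p.natDegree ≤ Module.finrank ℝ E ∧
      ∀ t : ℝ, p.eval t = (ContinuousLinearMap.id ℝ E + t • A).det := by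
  classical
  let b := Module.finBasis ℝ E
  let M := LinearMap.toMatrix b b (A : E →ₗ[ℝ] E)
  refine ⟨((X : ℝ[X]) • M.map C + (1 : Matrix _ _ ℝ).map C).det, ?_, fun t => ?_⟩
  · simpa using natDegree_det_X_add_C_le M 1
  · rw [ContinuousLinearMap.det, ← LinearMap.det_toMatrix b, ← Polynomial.coe_evalRingHom,
      RingHom.map_det]
    congr 1
    ext i j
    simp [M, Matrix.one_apply, LinearMap.toMatrix_apply, apply_ite, add_comm,
      Finsupp.single_apply, eq_comm]
    ring

/-- Interpolation of `det (1 + A)` by values of `det (1 + t A)` at small `t`, uniformly in `A`. -/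
theorem exists_interpolation_det_one_add (δ : ℝ) (hδ : 0 < δ) :
    ∃ (s : Finset ℕ) (t c : ℕ → ℝ), (∀ i, 0 < t i ∧ t i < δ) ∧ ∑ i ∈ s, c i = 1 ∧
      ∀ A : E →L[ℝ] E, (ContinuousLinearMap.id ℝ E + A).det =
        ∑ i ∈ s, c i * (ContinuousLinearMap.id ℝ E + t i • A).det := by
  -- The shift by 2 keeps the distinct nodes strictly below `δ`, also at `i = 0`. The weights are
  -- Lagrange basis polynomials at 1, hence independent of `A`, so the formula may be integrated
  -- over a family of operators.
  set t : ℕ → ℝ := fun i => δ / (i + 2) with ht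
  have hinj : Function.Injective t := by
    intro i j h
    simp only [ht] at h
    rw [div_eq_div_iff (by positivity) (by positivity)] at h
    have := mul_left_cancel₀ hδ.ne' h
    exact_mod_cast (add_right_cancel this).symm
  set s := Finset.range (Module.finrank ℝ E + 1) with hs
  have hsn : s.Nonempty := ⟨0, by simp [hs]⟩
  refine ⟨s, t, fun i => (Lagrange.basis s t i).eval 1, fun i => ⟨by positivity, ?_⟩, ?_, ?_⟩
  · rw [ht]
    apply div_lt_self hδ
    have : (0 : ℝ) ≤ i := by positivity
    linarith
  · rw [← Polynomial.eval_finsetSum, Lagrange.sum_basis hinj.injOn hsn, eval_one]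
  · intro A
    obtain ⟨p, hp, hpe⟩ := exists_polynomial_eval_eq_det_one_add_smul A
    have hd : p.degree < s.card := by
      rw [hs, Finset.card_range]
      refine lt_of_le_of_lt Polynomial.degree_le_natDegree ?_
      exact_mod_cast Nat.lt_succ_of_le hp
    have h := congrArg (Polynomial.eval 1) (Lagrange.eq_interpolate (v := t) hinj.injOn hd)
    rw [hpe, one_smul] at h
    rw [h, Lagrange.interpolate_apply, Polynomial.eval_finsetSum]
    refine Finset.sum_congr rfl fun i _ => ?_
    rw [eval_mul, eval_C, hpe, mul_comm]

/-- There is no continuously differentiable retraction of a ball to its boundary sphere. -/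
theorem not_contDiff_retraction (r : E → E) (hr : ContDiff ℝ 1 r) (h1 : ∀ x, ‖r x‖ = 1)
    (h2 : ∀ x, ‖x‖ = 1 → r x = x) : False := by
  borelize E
  let μ : Measure E := Measure.addHaar
  set h : E → E := fun x => r x - x with hh
  have hC1 : ContDiff ℝ 1 h := hr.sub contDiff_id
  have hdiff : ∀ x, HasStrictFDerivAt h (fderiv ℝ h x) x := fun x =>
    hC1.contDiffAt.hasStrictFDerivAt one_ne_zero
  have hcont : Continuous (fderiv ℝ h) := hC1.continuous_fderiv one_ne_zero
  obtain ⟨C, hC⟩ := (isCompact_closedBall (0 : E) 1).exists_bound_of_continuousOn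
    (f := fderiv ℝ h) hcont.continuousOn
  have hC0 : 0 ≤ C := (norm_nonneg _).trans (hC 0 (by simp))
  have hlip : ∀ x ∈ ball (0 : E) 1, ∀ y ∈ ball (0 : E) 1, ‖h y - h x‖ ≤ C * ‖y - x‖ := by
    intro x hx y hy
    exact (convex_ball (0 : E) 1).norm_image_sub_le_of_norm_hasFDerivWithin_le
      (fun z _ => (hdiff z).hasFDerivAt.hasFDerivWithinAt)
      (fun z hz => hC z (ball_subset_closedBall hz)) hx hy
  -- positivity of the determinant near the identity
  have hdet : ∀ᶠ A in 𝓝 (ContinuousLinearMap.id ℝ E), 0 < A.det := by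
    have hc : ContinuousAt (fun A : E →L[ℝ] E => A.det) (ContinuousLinearMap.id ℝ E) :=
      ContinuousLinearMap.continuous_det.continuousAt
    have h0 : (0 : ℝ) < (ContinuousLinearMap.id ℝ E).det := by
      simp [ContinuousLinearMap.det]
    exact hc.eventually (lt_mem_nhds h0)
  obtain ⟨η, hη, hηd⟩ := Metric.eventually_nhds_iff.1 hdet
  -- The three bounds serve injectivity of `x + t • h x`, positivity of its Jacobian, and its being
  -- a convex combination of `x` and `r x`.
  set δ : ℝ := min (1 / (C + 1)) (min (η / (C + 1)) 1) with hδ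
  have hδ0 : 0 < δ := by positivity
  -- For small `t` the map `x + t • h x` permutes the open ball, so its Jacobian integrates to the
  -- volume. Interpolation carries this value to `t = 1`, where the Jacobian is that of `r` and
  -- vanishes.
  have key : ∀ t : ℝ, 0 < t → t < δ →
      ∫ x in ball (0 : E) 1, (ContinuousLinearMap.id ℝ E + t • fderiv ℝ h x).det ∂μ =
        μ.real (ball (0 : E) 1) := by
    intro t ht0 htδ
    have ht1 : t < 1 := htδ.trans_le ((min_le_right _ _).trans (min_le_right _ _))
    have htC : t * C < 1 := by
      have : t < 1 / (C + 1) := htδ.trans_le (min_le_left _ _)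
      rw [lt_div_iff₀ (by positivity)] at this
      linarith
    have htη : t * C < η := by
      have : t < η / (C + 1) := htδ.trans_le ((min_le_right _ _).trans (min_le_left _ _))
      rw [lt_div_iff₀ (by positivity)] at this
      linarith
    set F : E → E := fun x => x + t • h x with hF
    have hFd : ∀ x, HasStrictFDerivAt F (ContinuousLinearMap.id ℝ E + t • fderiv ℝ h x) x :=
      fun x => (hasStrictFDerivAt_id x).add ((hdiff x).const_smul t)
    have hpos : ∀ x ∈ ball (0 : E) 1,
        0 < (ContinuousLinearMap.id ℝ E + t • fderiv ℝ h x).det := by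
      intro x hx
      apply hηd
      rw [dist_eq_norm, add_sub_cancel_left, norm_smul, Real.norm_of_nonneg ht0.le]
      exact (mul_le_mul_of_nonneg_left (hC x (ball_subset_closedBall hx)) ht0.le).trans_lt htη
    have hinj : InjOn F (ball 0 1) := by
      intro x hx y hy hxy
      have e : y - x = - (t • (h y - h x)) := by
        have : x + t • h x = y + t • h y := hxy
        rw [smul_sub, neg_sub, sub_eq_sub_iff_add_eq_add, ← this, add_comm]
      have := hlip x hx y hy
      have h3 : ‖y - x‖ ≤ t * C * ‖y - x‖ := by
        calc ‖y - x‖ = t * ‖h y - h x‖ := by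
              conv_lhs => rw [e]
              rw [norm_neg, norm_smul, Real.norm_of_nonneg ht0.le]
          _ ≤ t * (C * ‖y - x‖) := by gcongr
          _ = _ := by ring
      have h4 : ‖y - x‖ = 0 := by
        by_contra h5
        have : 0 < ‖y - x‖ := lt_of_le_of_ne (norm_nonneg _) (Ne.symm h5)
        nlinarith
      exact (sub_eq_zero.1 (norm_eq_zero.1 h4)).symm
    have hFr : ∀ x, F x = (1 - t) • x + t • r x := by
      intro x
      simp only [hF, hh, smul_sub, sub_smul, one_smul]
      abel
    have hmaps : F '' ball 0 1 ⊆ ball 0 1 := by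
      rintro _ ⟨x, hx, rfl⟩
      rw [mem_ball_zero_iff] at hx ⊢
      calc ‖F x‖ ≤ (1 - t) * ‖x‖ + t * ‖r x‖ := by
            rw [hFr]
            refine (norm_add_le _ _).trans ?_
            rw [norm_smul, norm_smul, Real.norm_of_nonneg ht0.le,
              Real.norm_of_nonneg (by linarith)]
        _ < 1 := by rw [h1]; nlinarith
    have hopen : IsOpen (F '' ball 0 1) := by
      rw [isOpen_iff_mem_nhds]
      rintro _ ⟨x, hx, rfl⟩
      have hs : HasStrictFDerivAt F
          ((ContinuousLinearMap.toContinuousLinearEquivOfDetNeZero _ (hpos x hx).ne' : E ≃L[ℝ] E) :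
            E →L[ℝ] E) x := by
        rw [ContinuousLinearMap.coe_toContinuousLinearEquivOfDetNeZero]
        exact hFd x
      rw [← hs.map_nhds_eq_of_equiv]
      exact image_mem_map (isOpen_ball.mem_nhds hx)
    have hFc : Continuous F := continuous_id.add (hC1.continuous.const_smul t)
    -- The image is open, and relatively closed in the ball: a limit point comes from the closed
    -- ball, whose boundary is fixed by `F`.
    have himage : F '' ball 0 1 = ball 0 1 := by
      refine hmaps.antisymm ((convex_ball (0 : E) 1).isPreconnected.subset_of_closure_inter_subset
        hopen ⟨F 0, hmaps ⟨0, by simp, rfl⟩, 0, by simp, rfl⟩ ?_)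
      rintro y ⟨hy, hyb⟩
      have hcl : closure (F '' ball 0 1) ⊆ F '' closedBall 0 1 :=
        closure_minimal (image_mono ball_subset_closedBall)
          ((isCompact_closedBall _ _).image hFc).isClosed
      obtain ⟨x, hx, rfl⟩ := hcl hy
      rw [mem_closedBall_zero_iff] at hx
      rcases hx.lt_or_eq with hx | hx
      · exact ⟨x, by simpa using hx, rfl⟩
      · exfalso
        rw [hFr, h2 x hx, ← add_smul, sub_add_cancel, one_smul, mem_ball_zero_iff] at hyb
        linarith
    have hcv := integral_image_eq_integral_abs_det_fderiv_smul μ measurableSet_ball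
      (fun x _ => (hFd x).hasFDerivAt.hasFDerivWithinAt) hinj (fun _ => (1 : ℝ))
    rw [himage] at hcv
    simp only [integral_const, smul_eq_mul, mul_one, MeasurableSet.univ, measureReal_restrict_apply,
      univ_inter] at hcv
    rw [hcv]
    exact setIntegral_congr_fun measurableSet_ball fun x hx => (abs_of_pos (hpos x hx)).symm
  have hvol : 0 < μ.real (ball (0 : E) 1) := by
    rw [Measure.real, ENNReal.toReal_pos_iff]
    exact ⟨measure_ball_pos _ _ one_pos, measure_ball_lt_top⟩
  have hzero : ∀ x, (ContinuousLinearMap.id ℝ E + fderiv ℝ h x).det = 0 := by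
    intro x
    have hrd : HasFDerivAt r (ContinuousLinearMap.id ℝ E + fderiv ℝ h x) x := by
      have := (hasFDerivAt_id x).add (hdiff x).hasFDerivAt
      refine this.congr_of_eventuallyEq (Eventually.of_forall fun y => ?_)
      simp [hh]
    by_contra hne
    -- A vector `v` sent by the derivative to `r x` gives `2 = 0` on differentiating `⟨r, r⟩ = 1` in
    -- direction `v`.
    have hsurj : Function.Surjective (ContinuousLinearMap.id ℝ E + fderiv ℝ h x) := by
      intro y
      obtain ⟨v, hv⟩ := (ContinuousLinearMap.toContinuousLinearEquivOfDetNeZero _ hne).surjective y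
      exact ⟨v, by simpa using hv⟩
    obtain ⟨v, hv⟩ := hsurj (r x)
    have hd := hrd.inner ℝ hrd
    have hconst : (fun y => inner ℝ (r y) (r y)) = fun _ => (1 : ℝ) := by
      ext y
      rw [real_inner_self_eq_norm_sq, h1, one_pow]
    rw [hconst] at hd
    have h0 := congrArg (fun L : E →L[ℝ] ℝ => L v) (hd.unique (hasFDerivAt_const (1 : ℝ) x))
    simp only [ContinuousLinearMap.comp_apply, fderivInnerCLM_apply,
      ContinuousLinearMap.prod_apply, hv, real_inner_self_eq_norm_sq, h1,
      zero_apply] at h0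
    norm_num at h0
  obtain ⟨s, t, c, ht, hc, hA⟩ := exists_interpolation_det_one_add (E := E) δ hδ0
  have hint : ∫ x in ball (0 : E) 1, ∑ i ∈ s, c i *
      (ContinuousLinearMap.id ℝ E + t i • fderiv ℝ h x).det ∂μ = μ.real (ball (0 : E) 1) := by
    rw [integral_finsetSum]
    · simp_rw [integral_const_mul]
      rw [Finset.sum_congr rfl fun i _ => by rw [key (t i) (ht i).1 (ht i).2],
        ← Finset.sum_mul, hc, one_mul]
    · intro i _
      -- A nonintegrable function has integral 0 by convention, so the positive value from `key`
      -- already proves integrability.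
      refine Integrable.const_mul (Integrable.of_integral_ne_zero ?_) _
      rw [key (t i) (ht i).1 (ht i).2]
      exact hvol.ne'
  have : ∫ x in ball (0 : E) 1, ∑ i ∈ s, c i *
      (ContinuousLinearMap.id ℝ E + t i • fderiv ℝ h x).det ∂μ = 0 := by
    simp_rw [← hA, hzero]
    simp
  linarith


/-- A form of Brouwer's fixed point theorem: a continuous map on the closed unit ball that moves
each point by at most one has a zero. -/
theorem exists_zero_of_norm_sub_le_one (H : E → E) (hH : ContinuousOn H (closedBall 0 1))
    (hd : ∀ x ∈ closedBall (0 : E) 1, ‖x - H x‖ ≤ 1) : ∃ x ∈ closedBall (0 : E) 1, H x = 0 := by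
  by_contra! hne
  set ρ : E → E := fun x => (max 1 ‖x‖)⁻¹ • x with hρ
  have hρc : Continuous ρ := by
    refine Continuous.smul (Continuous.inv₀ (by fun_prop) fun x => ?_) continuous_id
    positivity
  have hρm : ∀ x, ρ x ∈ closedBall (0 : E) 1 := by
    intro x
    rw [mem_closedBall_zero_iff, hρ, norm_smul, norm_inv, Real.norm_of_nonneg (by positivity),
      inv_mul_le_one₀ (by positivity)]
    exact le_max_right _ _
  set l : E → ℝ := fun x => min 1 (max 0 (‖x‖ - 1)) with hl
  have hlc : Continuous l := by fun_prop
  -- `F` equals `H` on the ball and fades radially into the identity between norms 1 and 2.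
  set F : E → E := fun x => (1 - l x) • H (ρ x) + l x • x with hF
  have hFc : Continuous F :=
    ((continuous_const.sub hlc).smul (hH.comp_continuous hρc hρm)).add (hlc.smul continuous_id)
  have hF0 : ∀ x, F x ≠ 0 := by
    intro x hx
    rcases le_or_gt ‖x‖ 1 with h | h
    · have h1 : l x = 0 := by simp [hl, max_eq_left (sub_nonpos.2 h)]
      have h2 : ρ x = x := by simp [hρ, max_eq_left h]
      simp only [hF, h1, h2, sub_zero, one_smul, zero_smul, add_zero] at hx
      exact hne x (by simpa using h) hx
    · have hn : ρ x = ‖x‖⁻¹ • x := by simp [hρ, max_eq_right h.le]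
      have he : ‖ρ x‖ = 1 := by
        rw [hn, norm_smul, norm_inv, norm_norm, inv_mul_cancel₀ (by positivity)]
      have hxe : x = ‖x‖ • ρ x := by
        rw [hn, smul_smul, mul_inv_cancel₀ (by positivity), one_smul]
      -- For a unit vector `e`, `‖e - H e‖ ≤ 1` gives `2⟨H e, e⟩ ≥ ‖H e‖² > 0`. The two summands of
      -- `F` therefore cannot cancel in direction `e`.
      have h1 : 0 < inner ℝ (H (ρ x)) (ρ x) := by
        have h3 := hd _ (hρm x)
        have h4 : ‖ρ x - H (ρ x)‖ ^ 2 ≤ 1 := by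
          rw [sq_le_one_iff₀ (norm_nonneg _)]
          exact h3
        rw [norm_sub_sq_real, he, real_inner_comm] at h4
        have h5 : 0 < ‖H (ρ x)‖ := norm_pos_iff.2 (hne _ (hρm x))
        nlinarith
      have h2 : 0 < l x := by
        simp only [hl, lt_min_iff, lt_max_iff]
        exact ⟨one_pos, Or.inr (by linarith)⟩
      have h3 : l x ≤ 1 := min_le_left _ _
      have h4 : inner ℝ (F x) (ρ x) = 0 := by rw [hx, inner_zero_left]
      have h5 : inner ℝ x (ρ x) = ‖x‖ := by
        have : inner ℝ (‖x‖ • ρ x) (ρ x) = ‖x‖ := by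
          rw [real_inner_smul_left, real_inner_self_eq_norm_sq, he, one_pow, mul_one]
        rwa [← hxe] at this
      rw [hF, inner_add_left, real_inner_smul_left, real_inner_smul_left, h5] at h4
      have h6 : 0 < l x * ‖x‖ := by positivity
      nlinarith [mul_nonneg (sub_nonneg.2 h3) h1.le]
  have hFid : ∀ x, 2 ≤ ‖x‖ → F x = x := by
    intro x hx
    have : l x = 1 := by
      simp only [hl]
      rw [max_eq_right (by linarith), min_eq_left (by linarith)]
    simp [hF, this]
  -- An error below `‖F x‖` keeps `g` free of zeros, and `g` is the identity from norm 3 on.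
  -- Rescaling by 3 and normalizing gives the forbidden retraction.
  obtain ⟨g, hg, hgd, hgS, -⟩ := hFc.exists_contDiff_approx_and_eqOn (ε := fun x => ‖F x‖) 1
    hFc.norm (fun x => norm_pos_iff.2 (hF0 x)) (S := {x | 3 ≤ ‖x‖}) (U := {x | 2 < ‖x‖})
    (isClosed_le continuous_const continuous_norm)
    ((isOpen_lt continuous_const continuous_norm).mem_nhdsSet.2 fun x hx =>
      lt_of_lt_of_le (by norm_num : (2 : ℝ) < 3) hx)
    (contDiffOn_id.congr fun x hx => hFid x (le_of_lt hx))
  have hg0 : ∀ x, g x ≠ 0 := by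
    intro x hx
    have := hgd x
    rw [hx, dist_zero_left] at this
    exact lt_irrefl _ this
  refine not_contDiff_retraction (fun x => ‖g ((3 : ℝ) • x)‖⁻¹ • g ((3 : ℝ) • x)) ?_ ?_ ?_
  · have h3 : ContDiff ℝ 1 fun x => g ((3 : ℝ) • x) := hg.comp (contDiff_const_smul (3 : ℝ))
    exact ((h3.norm ℝ fun x => hg0 _).inv fun x => norm_ne_zero_iff.2 (hg0 _)).smul h3
  · intro x
    rw [norm_smul, norm_inv, norm_norm, inv_mul_cancel₀ (norm_ne_zero_iff.2 (hg0 _))]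
  · intro x hx
    have h3 : ‖(3 : ℝ) • x‖ = 3 := by rw [norm_smul, hx]; norm_num
    have : g ((3 : ℝ) • x) = (3 : ℝ) • x := by
      rw [hgS (show (3 : ℝ) ≤ ‖(3 : ℝ) • x‖ by rw [h3]), hFid _ (by rw [h3]; norm_num)]
    simp only [this, h3, smul_smul]
    norm_num

/-- Local form of the invariance of domain, for the unit ball. -/
theorem image_closedBall_mem_nhds (f : E → E) (hf : ContinuousOn f (closedBall 0 1))
    (hinj : InjOn f (closedBall 0 1)) : f '' closedBall 0 1 ∈ 𝓝 (f 0) := by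
  borelize E
  by_contra hnot
  set K := f '' closedBall (0 : E) 1 with hK
  have hKc : IsCompact K := (isCompact_closedBall _ _).image_of_continuousOn hf
  -- a continuous extension of the inverse of `f`
  obtain ⟨G, hG⟩ : ∃ G : C(E, E), ∀ x ∈ closedBall (0 : E) 1, G (f x) = x := by
    have hemb : IsClosedEmbedding ((closedBall (0 : E) 1).domRestrict f) := by
      have : CompactSpace (closedBall (0 : E) 1) :=
        isCompact_iff_compactSpace.1 (isCompact_closedBall _ _)
      exact Continuous.isClosedEmbedding (continuousOn_iff_continuous_domRestrict.1 hf)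
        (injOn_iff_injective.1 hinj)
    obtain ⟨G, hG⟩ := ContinuousMap.exists_extension' hemb
      (⟨Subtype.val, continuous_subtype_val⟩ : C(closedBall (0 : E) 1, E))
    exact ⟨G, fun x hx => congrFun hG ⟨x, hx⟩⟩
  have h0 : (0 : E) ∈ closedBall (0 : E) 1 := by simp
  obtain ⟨ε', hε', hGε⟩ := Metric.continuousAt_iff.1 (G.continuous.continuousAt (x := f 0))
    (1 / 10) (by norm_num)
  rw [hG 0 h0] at hGε
  set ε := ε' / 2 with hε
  have hε0 : 0 < ε := by positivity
  have hGε2 : ∀ y, dist y (f 0) < 2 * ε → ‖G y‖ < 1 / 10 := by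
    intro y hy
    have := hGε (x := y) (by rw [hε] at hy; linarith)
    rwa [dist_zero_right] at this
  obtain ⟨c, hc, hcK⟩ : ∃ c ∈ ball (f 0) ε, c ∉ K := by
    by_contra! h
    exact hnot (mem_of_superset (ball_mem_nhds _ hε0) h)
  rw [mem_ball, dist_comm] at hc
  -- The only zero of `G` on `K` is `f 0`, which lies within `ε` of `c`. So `G` is bounded away from
  -- zero on `S`.
  set S := K ∩ {y | ε ≤ dist y c} with hS
  have hSc : IsCompact S := hKc.inter_right
    (isClosed_le continuous_const (continuous_id.dist continuous_const))
  have hSG : ∀ y ∈ S, G y ≠ 0 := by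
    rintro _ ⟨⟨x, hx, rfl⟩, hy⟩ h
    rw [hG x hx] at h
    subst h
    exact absurd hc (not_lt.2 hy)
  obtain ⟨δ, hδ0, hδ1, hδ⟩ : ∃ δ : ℝ, 0 < δ ∧ δ ≤ 1 / 10 ∧ ∀ y ∈ S, δ ≤ ‖G y‖ := by
    rcases S.eq_empty_or_nonempty with h | h
    · exact ⟨1 / 10, by norm_num, le_rfl, by simp [h]⟩
    · obtain ⟨y, hy, hm⟩ := hSc.exists_isMinOn h G.continuous.norm.continuousOn
      exact ⟨min (1 / 10) ‖G y‖, lt_min (by norm_num) (norm_pos_iff.2 (hSG y hy)), min_le_left _ _,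
        fun z hz => (min_le_right _ _).trans (hm hz)⟩
  obtain ⟨P, hP, hPd, -⟩ := G.continuous.exists_contDiff_approx (ε := fun _ => δ / 2) 1
    continuous_const (fun _ => by positivity)
  -- A `C¹` map sends the sphere to a null set, so a small `v` makes `P - v` nonvanishing there.
  obtain ⟨v, hv, hvP⟩ : ∃ v ∈ ball (0 : E) (δ / 2), v ∉ P '' sphere c ε := by
    by_contra! h
    have hnull : (Measure.addHaar : Measure E) (P '' sphere c ε) = 0 :=
      addHaar_image_eq_zero_of_differentiableOn_of_addHaar_eq_zero _
        (hP.differentiable one_ne_zero).differentiableOn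
        (Measure.addHaar_sphere_of_ne_zero _ _ hε0.ne')
    exact (measure_ball_pos (Measure.addHaar : Measure E) (0 : E) (half_pos hδ0)).ne'
      (measure_mono_null h hnull)
  rw [mem_ball_zero_iff] at hv
  have hPG : ∀ y, ‖G y - (P y - v)‖ < δ := by
    intro y
    have h1 := hPd y
    rw [dist_eq_norm] at h1
    calc ‖G y - (P y - v)‖ = ‖v - (P y - G y)‖ := by congr 1; abel
      _ ≤ ‖v‖ + ‖P y - G y‖ := norm_sub_le _ _
      _ < δ := by linarith
  -- Points of `K` within `ε` of `c` are pushed radially onto the sphere and the others stay. This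
  -- is continuous on `K` because `c ∉ K`.
  set Φ : E → E := fun y => c + max 1 (ε / dist y c) • (y - c) with hΦ
  have hΦfar : ∀ y, ε ≤ dist y c → Φ y = y := by
    intro y hy
    have : ε / dist y c ≤ 1 := div_le_one_of_le₀ hy dist_nonneg
    simp [hΦ, max_eq_left this]
  have hΦnear : ∀ y ∈ K, dist y c < ε → Φ y ∈ sphere c ε := by
    intro y hyK hy
    have hpos : 0 < dist y c := dist_pos.2 fun h => hcK (h ▸ hyK)
    have : 1 ≤ ε / dist y c := (one_le_div₀ hpos).2 hy.le
    rw [mem_sphere_iff_norm, hΦ]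
    simp only [add_sub_cancel_left, max_eq_right this]
    rw [norm_smul, Real.norm_of_nonneg (by positivity), ← dist_eq_norm, div_mul_cancel₀ _ hpos.ne']
  have hΦc : ContinuousOn Φ K := by
    refine continuousOn_const.add (ContinuousOn.smul (ContinuousOn.sup continuousOn_const
      (continuousOn_const.div (by fun_prop) fun y hy => ?_)) (by fun_prop))
    exact dist_ne_zero.2 fun h => hcK (h ▸ hy)
  -- The map stays close to the identity, so it has a zero. The bound `δ` on `S` and the choice of
  -- `v` on the sphere exclude one.
  obtain ⟨x, hx, hx0⟩ := exists_zero_of_norm_sub_le_one (fun x => P (Φ (f x)) - v)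
    ((hP.continuous.comp_continuousOn (hΦc.comp hf (mapsTo_image _ _))).sub continuousOn_const) (by
      intro x hx
      rcases le_or_gt ε (dist (f x) c) with h | h
      · simp only [hΦfar _ h]
        have := hPG (f x)
        rw [hG x hx] at this
        linarith
      · have h1 := hΦnear _ (mem_image_of_mem f hx) h
        rw [mem_sphere] at h1
        have h2 := hGε2 (Φ (f x)) (by
          have := dist_triangle (Φ (f x)) c (f 0)
          rw [dist_comm c] at this
          linarith)
        have h3 := hGε2 (f x) (by
          have := dist_triangle (f x) c (f 0)
          rw [dist_comm c] at this
          linarith)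
        rw [hG x hx] at h3
        have h4 := hPG (Φ (f x))
        calc ‖x - (P (Φ (f x)) - v)‖
            = ‖x - G (Φ (f x)) + (G (Φ (f x)) - (P (Φ (f x)) - v))‖ := by congr 1; abel
          _ ≤ ‖x‖ + ‖G (Φ (f x))‖ + ‖G (Φ (f x)) - (P (Φ (f x)) - v)‖ :=
              (norm_add_le _ _).trans (by gcongr; exact norm_sub_le _ _)
          _ ≤ 1 := by linarith)
  rcases le_or_gt ε (dist (f x) c) with h | h
  · simp only [hΦfar _ h] at hx0
    have h1 := hPG (f x)
    rw [hx0, sub_zero] at h1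
    exact absurd (hδ _ ⟨mem_image_of_mem f hx, h⟩) (not_le.2 h1)
  · exact hvP ⟨_, hΦnear _ (mem_image_of_mem f hx) h, sub_eq_zero.1 hx0⟩

/-- Invariance of domain. -/
theorem isOpen_image_of_continuousOn_injOn {f : E → E} {U : Set E} (hU : IsOpen U)
    (hf : ContinuousOn f U) (hinj : InjOn f U) : IsOpen (f '' U) := by
  rw [isOpen_iff_mem_nhds]
  rintro _ ⟨a, ha, rfl⟩
  obtain ⟨ε, hε, hεU⟩ := Metric.isOpen_iff.1 hU a ha
  set φ : E → E := fun x => a + (ε / 2) • x with hφ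
  have hmaps : MapsTo φ (closedBall 0 1) U := by
    intro x hx
    rw [mem_closedBall_zero_iff] at hx
    apply hεU
    rw [mem_ball, dist_eq_norm, hφ]
    simp only [add_sub_cancel_left]
    rw [norm_smul, Real.norm_of_nonneg (by positivity)]
    nlinarith
  have hφinj : Function.Injective φ := fun x y h =>
    smul_right_injective E (half_pos hε).ne' (add_left_cancel h)
  have := image_closedBall_mem_nhds (f ∘ φ) (hf.comp (by fun_prop) hmaps)
    (hinj.comp hφinj.injOn hmaps)
  simp only [hφ, Function.comp_apply, smul_zero, add_zero] at this
  refine mem_of_superset this ?_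
  rintro _ ⟨x, hx, rfl⟩
  exact ⟨φ x, hmaps hx, rfl⟩

end NoRetraction

/-- Invariance of domain for `Fin n → ℝ`. -/
theorem isOpen_image_pi_of_continuousOn_injOn {n : ℕ} {f : (Fin n → ℝ) → (Fin n → ℝ)}
    {U : Set (Fin n → ℝ)} (hU : IsOpen U) (hf : ContinuousOn f U) (hinj : InjOn f U) :
    IsOpen (f '' U) := by
  let e : EuclideanSpace ℝ (Fin n) ≃ₜ (Fin n → ℝ) :=
    (EuclideanSpace.equiv (Fin n) ℝ).toHomeomorph
  have h := isOpen_image_of_continuousOn_injOn (f := e.symm ∘ f ∘ e) (U := e ⁻¹' U)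
    (hU.preimage e.continuous)
    (e.symm.continuous.comp_continuousOn (hf.comp e.continuous.continuousOn (mapsTo_preimage _ _)))
    (e.symm.injective.comp_injOn (hinj.comp e.injective.injOn (mapsTo_preimage _ _)))
  rw [image_comp, image_comp, image_preimage_eq _ e.surjective] at h
  exact e.symm.isOpen_image.1 h

/-! ### Invariance of domain on spheres -/

section SphereDomain

/-- Invariance of domain for relatively open subsets of the unit sphere of `Fin (n + 1) → ℝ`. -/
theorem isOpen_image_inter_sphere {n : ℕ} {ψ : (Fin (n + 1) → ℝ) → (Fin n → ℝ)}
    {U : Set (Fin (n + 1) → ℝ)} (hU : IsOpen U) (hψ : ContinuousOn ψ (U ∩ sphere 0 1))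
    (hinj : InjOn ψ (U ∩ sphere 0 1)) : IsOpen (ψ '' (U ∩ sphere 0 1)) := by
  set ν : (Fin (n + 1) → ℝ) → (Fin (n + 1) → ℝ) := fun u => ‖u‖⁻¹ • u with hν
  have hνc : ContinuousOn ν {0}ᶜ :=
    (continuousOn_id.norm.inv₀ fun u hu => norm_ne_zero_iff.2 hu).smul continuousOn_id
  have hν1 : ∀ u, u ≠ 0 → ‖ν u‖ = 1 := fun u hu => by
    rw [hν, norm_smul, norm_inv, norm_norm, inv_mul_cancel₀ (norm_ne_zero_iff.2 hu)]
  set W := {0}ᶜ ∩ ν ⁻¹' U with hW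
  have hWo : IsOpen W := hνc.isOpen_inter_preimage isOpen_compl_singleton hU
  have hmaps : MapsTo ν W (U ∩ sphere 0 1) := fun u hu =>
    ⟨hu.2, by rw [mem_sphere_zero_iff_norm]; exact hν1 u hu.1⟩
  -- Polar coordinates thicken the piece of the sphere to an open cone, to which the theorem for
  -- open sets applies. The slice at radius 1 recovers the image of `ψ`.
  set F : (Fin (n + 1) → ℝ) → (Fin (n + 1) → ℝ) := fun u => Fin.cons ‖u‖ (ψ (ν u)) with hF
  have hFc : ContinuousOn F W := by
    rw [continuousOn_pi]
    intro i
    have h1 : ContinuousOn (fun u => ψ (ν u)) W := hψ.comp (hνc.mono inter_subset_left) hmaps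
    refine Fin.cases ?_ (fun j => ?_) i
    · simpa [hF] using continuousOn_id.norm
    · simpa [hF] using continuousOn_pi.1 h1 j
  have hFi : InjOn F W := by
    intro u hu v hv h
    obtain ⟨h1, h2⟩ := Fin.cons_injective2 h
    have h3 : ‖u‖⁻¹ • u = ‖v‖⁻¹ • v := hinj (hmaps hu) (hmaps hv) h2
    rw [← h1] at h3
    exact smul_right_injective _ (inv_ne_zero (norm_ne_zero_iff.2 hu.1)) h3
  have hopen := isOpen_image_pi_of_continuousOn_injOn hWo hFc hFi
  have hc : Continuous fun a : Fin n → ℝ => (Fin.cons 1 a : Fin (n + 1) → ℝ) := by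
    refine continuous_pi fun i => Fin.cases ?_ (fun j => ?_) i
    · simpa using continuous_const
    · simpa using continuous_apply j
  convert hopen.preimage hc using 1
  ext a
  constructor
  · rintro ⟨u, ⟨huU, hu⟩, rfl⟩
    rw [mem_sphere_zero_iff_norm] at hu
    have hνu : ν u = u := by simp [hν, hu]
    refine ⟨u, ⟨fun h => ?_, by simpa [hνu] using huU⟩, by simp only [hF, hνu, hu]⟩
    rw [mem_singleton_iff.1 h, norm_zero] at hu
    exact zero_ne_one hu
  · rintro ⟨u, hu, h⟩
    exact ⟨ν u, hmaps hu, (Fin.cons_injective2 h).2⟩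

/-- A nonempty relatively open subset of the `n`-dimensional unit sphere does not embed into a
lower dimensional space. -/
theorem inter_sphere_eq_empty_of_injOn {n m : ℕ} (hmn : m < n)
    {ψ : (Fin (n + 1) → ℝ) → (Fin m → ℝ)}
    {U : Set (Fin (n + 1) → ℝ)} (hU : IsOpen U) (hψ : ContinuousOn ψ (U ∩ sphere 0 1))
    (hinj : InjOn ψ (U ∩ sphere 0 1)) : U ∩ sphere 0 1 = ∅ := by
  -- Padding with zeros puts the image into a hyperplane, which contains no nonempty open set.
  set ι : (Fin m → ℝ) → (Fin n → ℝ) := fun a i => if h : (i : ℕ) < m then a ⟨i, h⟩ else 0 with hι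
  have hιc : Continuous ι := by
    refine continuous_pi fun i => ?_
    by_cases h : (i : ℕ) < m
    · simpa [hι, h] using continuous_apply _
    · simpa [hι, h] using continuous_const
  have hιi : Function.Injective ι := by
    intro a b h
    ext i
    have := congrFun h ⟨i, i.2.trans hmn⟩
    simpa [hι] using this
  have hopen := isOpen_image_inter_sphere hU (hιc.comp_continuousOn hψ) (hιi.comp_injOn hinj)
  by_contra hne
  obtain ⟨u, hu⟩ := nonempty_iff_ne_empty.2 hne
  set y := ι (ψ u) with hy
  set j : Fin n := ⟨m, hmn⟩ with hj
  have hzero : ∀ a ∈ (ι ∘ ψ) '' (U ∩ sphere 0 1), a j = 0 := by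
    rintro _ ⟨v, -, rfl⟩
    simp [hι, hj]
  have hcont : Continuous fun t : ℝ => Function.update y j t :=
    continuous_const.update j continuous_id
  have hev : ∀ᶠ t in 𝓝 (0 : ℝ), Function.update y j t ∈ (ι ∘ ψ) '' (U ∩ sphere 0 1) := by
    refine hcont.continuousAt.eventually_mem (hopen.mem_nhds ?_)
    have : Function.update y j 0 = y := by
      rw [← hzero y ⟨u, hu, rfl⟩, Function.update_eq_self]
    rw [this]
    exact ⟨u, hu, rfl⟩
  obtain ⟨t, ht, ht0⟩ := ((hev.filter_mono nhdsWithin_le_nhds).and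
    (self_mem_nhdsWithin : {0}ᶜ ∈ 𝓝[≠] (0 : ℝ))).exists
  have := hzero _ ht
  simp only [Function.update_self] at this
  exact ht0 this

theorem continuousOn_invFunOn_of_isCompact {α β : Type*} [TopologicalSpace α] [TopologicalSpace β]
    [T2Space β] [Nonempty α] {f : α → β} {s : Set α} (hs : IsCompact s) (hf : ContinuousOn f s)
    (hinj : InjOn f s) : ContinuousOn (Function.invFunOn f s) (f '' s) := by
  rw [continuousOn_iff_isClosed]
  intro t ht
  refine ⟨f '' (s ∩ t), ((hs.inter_right ht).image_of_continuousOn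
    (hf.mono inter_subset_left)).isClosed, ?_⟩
  ext b
  constructor
  · rintro ⟨hb, a, ha, rfl⟩
    rw [mem_preimage, hinj.leftInvOn_invFunOn ha] at hb
    exact ⟨⟨a, ⟨ha, hb⟩, rfl⟩, a, ha, rfl⟩
  · rintro ⟨⟨a, ⟨ha, hat⟩, rfl⟩, -⟩
    exact ⟨by rwa [mem_preimage, hinj.leftInvOn_invFunOn ha], a, ha, rfl⟩

end SphereDomain

/-! ### Incidence of cells in regular CW complexes -/

section RegularCW

open RelCWComplex

variable {X : Type u} [TopologicalSpace X] {K : Set X} [CWComplex K]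

theorem disjoint_cellFrontier_openCell {n m : ℕ} (hnm : n ≤ m) (i : cell K n) (j : cell K m) :
    Disjoint (cellFrontier (C := K) n i) (openCell (C := K) m j) := by
  rw [Set.disjoint_left]
  intro p hp hpj
  obtain ⟨I, hI⟩ := CWComplex.cellFrontier_subset_finite_openCell (C := K) n i
  have hm := hI hp
  simp only [mem_iUnion] at hm
  obtain ⟨l, hl, k, -, hk⟩ := hm
  have := congrArg Sigma.fst (eq_of_not_disjoint_openCell (C := K) (j := k) (i := j)
    (Set.not_disjoint_iff.2 ⟨_, hk, hpj⟩))
  simp only at this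
  omega

/-- Regularity gives injectivity on the sphere and the CW structure gives it on the open ball. The
two images are disjoint because the frontier lies in open cells of lower dimension. -/
theorem IsRegularCW.injOn_closedBall (hK : IsRegularCW K) (n : ℕ) (e : cell K n) :
    InjOn (map (C := K) n e) (closedBall 0 1) := by
  have hmix : ∀ a ∈ sphere (0 : Fin n → ℝ) 1, ∀ b ∈ ball (0 : Fin n → ℝ) 1,
      map (C := K) n e a ≠ map (C := K) n e b := fun a ha b hb h =>
    Set.disjoint_left.1 (disjoint_cellFrontier_openCell le_rfl e e) (mem_image_of_mem _ ha)
      (h ▸ mem_image_of_mem _ hb)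
  intro a ha b hb h
  rw [← sphere_union_ball] at ha hb
  rcases ha with ha | ha <;> rcases hb with hb | hb
  · exact congrArg Subtype.val ((hK n e).injective (a₁ := ⟨a, ha⟩) (a₂ := ⟨b, hb⟩) h)
  · exact absurd h (hmix a ha b hb)
  · exact absurd h.symm (hmix b hb a ha)
  · have := (map (C := K) n e).injOn
    rw [source_eq] at this
    exact this ha hb h

/-- The inverse of the characteristic map of a cell of a regular CW complex. -/
noncomputable def chart (n : ℕ) (e : cell K n) : X → (Fin n → ℝ) :=
  Function.invFunOn (map (C := K) n e) (closedBall 0 1)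

theorem chart_mem {n : ℕ} {e : cell K n} {p : X} (hp : p ∈ closedCell (C := K) n e) :
    chart n e p ∈ closedBall (0 : Fin n → ℝ) 1 :=
  Function.invFunOn_mem hp

theorem map_chart {n : ℕ} {e : cell K n} {p : X} (hp : p ∈ closedCell (C := K) n e) :
    map (C := K) n e (chart n e p) = p :=
  Function.invFunOn_eq hp

theorem IsRegularCW.chart_map (hK : IsRegularCW K) {n : ℕ} {e : cell K n} {a : Fin n → ℝ}
    (ha : a ∈ closedBall (0 : Fin n → ℝ) 1) : chart n e (map (C := K) n e a) = a :=
  (hK.injOn_closedBall n e).leftInvOn_invFunOn ha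

theorem chart_injOn {n : ℕ} {e : cell K n} :
    InjOn (chart n e) (closedCell (C := K) n e) := fun p hp q hq h => by
  rw [← map_chart hp, h, map_chart hq]

variable {n : ℕ} {y : cell K (n + 1)} {U : Set (Fin (n + 1) → ℝ)}

theorem IsRegularCW.injOn_chart_map (hK : IsRegularCW K) {m : ℕ} {e : cell K m}
    (h : MapsTo (map (C := K) (n + 1) y) (U ∩ sphere 0 1) (closedCell (C := K) m e)) :
    InjOn (chart m e ∘ map (C := K) (n + 1) y) (U ∩ sphere 0 1) :=
  chart_injOn.comp ((hK.injOn_closedBall (n + 1) y).mono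
    (inter_subset_right.trans sphere_subset_closedBall)) h

/-- The points of an open piece of the boundary sphere of a cell that are mapped outside a closed
set form an open piece of the sphere. -/
theorem exists_isOpen_inter_sphere_eq (hU : IsOpen U) {A : Set X} (hA : IsClosed A) :
    ∃ V, IsOpen V ∧ V ∩ sphere 0 1 =
      {u ∈ U ∩ sphere 0 1 | map (C := K) (n + 1) y u ∉ A} := by
  obtain ⟨V, hV, h⟩ := (continuousOn_iff'.1 ((continuousOn (n + 1) y).mono
    sphere_subset_closedBall)) Aᶜ hA.isOpen_compl
  refine ⟨U ∩ V, hU.inter hV, ?_⟩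
  rw [inter_assoc, ← h]
  ext u
  simp only [mem_inter_iff, mem_preimage, mem_compl_iff, mem_ofPred_eq]
  tauto

/-- The union of the closed cells of dimension at most `m` in a finite family, except one. -/
def closedCellsExcept (I : (m : ℕ) → Finset (cell K m)) {m : ℕ} (e : cell K m) : Set X :=
  ⋃ l ∈ Finset.range (m + 1), ⋃ j ∈ I l, ⋃ (_ : (⟨l, j⟩ : Σ l, cell K l) ≠ ⟨m, e⟩),
    closedCell (C := K) l j

theorem disjoint_closedCellsExcept (I : (m : ℕ) → Finset (cell K m)) {m : ℕ} (e : cell K m) :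
    Disjoint (closedCellsExcept I e) (openCell (C := K) m e) := by
  simp only [closedCellsExcept, disjoint_iUnion_left, Finset.mem_range]
  intro l hl j _ hne
  rw [← cellFrontier_union_openCell_eq_closedCell, disjoint_union_left]
  exact ⟨disjoint_cellFrontier_openCell (by omega) j e, disjoint_openCell_of_ne hne⟩

theorem mem_openCell_of_notMem_closedCellsExcept {I : (m : ℕ) → Finset (cell K m)} {m : ℕ}
    {e : cell K m} {p : X}
    (hp : p ∈ ⋃ (l : ℕ) (_ : l < m + 1) (j ∈ I l), openCell (C := K) l j)
    (h : p ∉ closedCellsExcept I e) : p ∈ openCell (C := K) m e := by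
  simp only [mem_iUnion] at hp
  obtain ⟨l, hl, j, hj, hpj⟩ := hp
  by_contra hpe
  apply h
  simp only [closedCellsExcept, mem_iUnion, Finset.mem_range]
  refine ⟨l, hl, j, hj, fun heq => hpe ?_, openCell_subset_closedCell _ _ hpj⟩
  cases heq
  exact hpj

variable [T2Space X]

theorem isClosed_closedCellsExcept (I : (m : ℕ) → Finset (cell K m)) {m : ℕ} (e : cell K m) :
    IsClosed (closedCellsExcept I e) := by
  refine isClosed_biUnion_finset fun l _ => isClosed_biUnion_finset fun j _ => ?_
  by_cases h : (⟨l, j⟩ : Σ l, cell K l) ≠ ⟨m, e⟩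
  · simpa [h] using isClosed_closedCell
  · simp [h]

theorem IsRegularCW.continuousOn_chart (hK : IsRegularCW K) (n : ℕ) (e : cell K n) :
    ContinuousOn (chart n e) (closedCell (C := K) n e) :=
  continuousOn_invFunOn_of_isCompact (isCompact_closedBall _ _) (continuousOn n e)
    (hK.injOn_closedBall n e)

theorem IsRegularCW.continuousOn_chart_map (hK : IsRegularCW K) {m : ℕ} {e : cell K m}
    (h : MapsTo (map (C := K) (n + 1) y) (U ∩ sphere 0 1) (closedCell (C := K) m e)) :
    ContinuousOn (chart m e ∘ map (C := K) (n + 1) y) (U ∩ sphere 0 1) :=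
  (hK.continuousOn_chart m e).comp ((continuousOn (n + 1) y).mono
    (inter_subset_right.trans sphere_subset_closedBall)) h

/-- If the boundary of an `(n + 1)`-cell meets an open `n`-cell, then it contains the closed
cell. -/
theorem IsRegularCW.closedCell_subset_cellFrontier (hK : IsRegularCW K) {e : cell K n} {p : X}
    (hpy : p ∈ cellFrontier (C := K) (n + 1) y) (hpe : p ∈ openCell (C := K) n e) :
    closedCell (C := K) n e ⊆ cellFrontier (C := K) (n + 1) y := by
  obtain ⟨I, hI⟩ := CWComplex.cellFrontier_subset_finite_openCell (C := K) (n + 1) y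
  obtain ⟨V, hV, hVeq⟩ := exists_isOpen_inter_sphere_eq (y := y) isOpen_univ
    (isClosed_closedCellsExcept I e)
  have hmem : ∀ u, u ∈ V ∩ sphere 0 1 ↔
      u ∈ sphere 0 1 ∧ map (C := K) (n + 1) y u ∈ openCell (C := K) n e := by
    intro u
    rw [hVeq]
    simp only [univ_inter, mem_ofPred_eq]
    refine and_congr_right fun hu => ⟨fun h => ?_, fun h h' => ?_⟩
    · exact mem_openCell_of_notMem_closedCellsExcept (hI (mem_image_of_mem _ hu)) h
    · exact Set.disjoint_left.1 (disjoint_closedCellsExcept I e) h' h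
  have hmaps : MapsTo (map (C := K) (n + 1) y) (V ∩ sphere 0 1) (closedCell (C := K) n e) :=
    fun u hu => openCell_subset_closedCell _ _ ((hmem u).1 hu).2
  have hopen := isOpen_image_inter_sphere hV (hK.continuousOn_chart_map hmaps)
    (hK.injOn_chart_map hmaps)
  set T := (chart n e ∘ map (C := K) (n + 1) y) '' (V ∩ sphere 0 1) with hT
  have hTmem : ∀ b ∈ ball (0 : Fin n → ℝ) 1,
      b ∈ T ↔ map (C := K) n e b ∈ cellFrontier (C := K) (n + 1) y := by
    intro b hb
    constructor
    · rintro ⟨u, hu, rfl⟩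
      rw [Function.comp_apply, map_chart (hmaps hu)]
      exact mem_image_of_mem _ hu.2
    · rintro ⟨u, hu, h⟩
      refine ⟨u, (hmem u).2 ⟨hu, h ▸ mem_image_of_mem _ hb⟩, ?_⟩
      rw [Function.comp_apply, h, hK.chart_map (ball_subset_closedBall hb)]
  -- `T` is open by invariance of domain and closed in the ball because the frontier is closed.
  -- Connectedness of the ball finishes.
  have hball : ball (0 : Fin n → ℝ) 1 ⊆ T := by
    refine (convex_ball (0 : Fin n → ℝ) 1).isPreconnected.subset_of_closure_inter_subset hopen
      ?_ ?_
    · obtain ⟨b, hb, rfl⟩ := hpe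
      exact ⟨b, hb, (hTmem b hb).2 hpy⟩
    · rintro b ⟨hb, hbb⟩
      rw [hTmem b hbb]
      have hcl : IsClosed (closedBall (0 : Fin n → ℝ) 1 ∩
          map (C := K) n e ⁻¹' cellFrontier (C := K) (n + 1) y) :=
        (continuousOn n e).preimage_isClosed_of_isClosed isClosed_closedBall isClosed_cellFrontier
      have hsub : T ⊆ closedBall (0 : Fin n → ℝ) 1 ∩
          map (C := K) n e ⁻¹' cellFrontier (C := K) (n + 1) y := by
        rintro _ ⟨u, hu, rfl⟩
        refine ⟨chart_mem (hmaps hu), ?_⟩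
        rw [mem_preimage, Function.comp_apply, map_chart (hmaps hu)]
        exact mem_image_of_mem _ hu.2
      exact (closure_minimal hsub hcl hb).2
  rw [← closure_openCell_eq_closedCell]
  refine closure_minimal ?_ isClosed_cellFrontier
  rintro _ ⟨b, hb, rfl⟩
  exact (hTmem b hb).1 (hball hb)

/-- A nonempty open piece of the boundary of an `(n + 1)`-cell is not covered by finitely many
cells of dimension less than `n`. -/
theorem IsRegularCW.inter_sphere_eq_empty (hK : IsRegularCW K) (I : (m : ℕ) → Finset (cell K m)) :
    ∀ (M : ℕ), M ≤ n → ∀ U : Set (Fin (n + 1) → ℝ), IsOpen U →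
      MapsTo (map (C := K) (n + 1) y) (U ∩ sphere 0 1)
        (⋃ (l : ℕ) (_ : l < M) (j ∈ I l), openCell (C := K) l j) → U ∩ sphere 0 1 = ∅ := by
  intro M
  induction M with
  | zero =>
    intro _ U _ h
    rw [eq_empty_iff_forall_notMem]
    intro u hu
    simpa using h hu
  | succ M ih =>
    intro hM U hU h
    refine ih (by omega) U hU fun u hu => ?_
    have hu' := h hu
    simp only [mem_iUnion] at hu' ⊢
    obtain ⟨l, hl, j, hj, huj⟩ := hu'
    rcases Nat.lt_succ_iff_lt_or_eq.1 hl with hl | rfl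
    · exact ⟨l, hl, j, hj, huj⟩
    · exfalso
      -- Removing the other closed cells leaves an open piece mapped into the single `l`-cell `j`,
      -- hence embedded in dimension `l < n`.
      obtain ⟨V, hV, hVeq⟩ := exists_isOpen_inter_sphere_eq (y := y) hU
        (isClosed_closedCellsExcept I j)
      have hmaps : MapsTo (map (C := K) (n + 1) y) (V ∩ sphere 0 1) (closedCell (C := K) l j) := by
        intro v hv
        rw [hVeq] at hv
        exact openCell_subset_closedCell _ _
          (mem_openCell_of_notMem_closedCellsExcept (h hv.1) hv.2)
      have hempty := inter_sphere_eq_empty_of_injOn (by omega) hV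
        (hK.continuousOn_chart_map hmaps) (hK.injOn_chart_map hmaps)
      rw [hVeq] at hempty
      exact eq_empty_iff_forall_notMem.1 hempty u
        ⟨hu, fun h' => Set.disjoint_left.1 (disjoint_closedCellsExcept I j) h' huj⟩

/-- In a regular CW complex, between a `k`-cell and a `(k + 2)`-cell there are at least two
`(k + 1)`-cells if there is one. -/
theorem IsRegularCW.exists_ne_between_aux (hK : IsRegularCW K) {k : ℕ} (v : cell K k)
    (x : cell K (k + 1)) (y : cell K (k + 1 + 1))
    (hvx : closedCell (C := K) k v ⊆ closedCell (C := K) (k + 1) x)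
    (hxy : closedCell (C := K) (k + 1) x ⊆ closedCell (C := K) (k + 1 + 1) y) :
    ∃ x' : cell K (k + 1), x' ≠ x ∧ closedCell (C := K) k v ⊆ closedCell (C := K) (k + 1) x' ∧
      closedCell (C := K) (k + 1) x' ⊆ closedCell (C := K) (k + 1 + 1) y := by
  -- Suppose `x` is the only cell between. Near the center `p` of `v`, the boundary of `y` then
  -- meets no open `(k+1)`-cell but `x`, and lower cells cannot fill an open piece. So it lies in
  -- the closed cell `x` there, and invariance of domain puts `p` into the open cell `x`.
  by_contra! hcon
  set p := map (C := K) k v 0 with hp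
  have hpv : p ∈ openCell (C := K) k v := map_zero_mem_openCell _ _
  have hpx : p ∈ closedCell (C := K) (k + 1) x := hvx (openCell_subset_closedCell _ _ hpv)
  have hnot : ∀ {m : ℕ} (e : cell K m), k ≠ m → p ∉ openCell (C := K) m e := fun e hne h =>
    hne (congrArg Sigma.fst (eq_of_not_disjoint_openCell (C := K) (j := v) (i := e)
      (Set.not_disjoint_iff.2 ⟨_, hpv, h⟩)))
  have hpf : ∀ {m : ℕ} (e : cell K m), k ≠ m → p ∈ closedCell (C := K) m e →
      p ∈ cellFrontier (C := K) m e := by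
    intro m e hne h
    rw [← cellFrontier_union_openCell_eq_closedCell] at h
    exact h.resolve_right (hnot e hne)
  obtain ⟨u₀, hu₀, hu₀p⟩ := hpf y (by omega) (hxy hpx)
  obtain ⟨I, hI⟩ := CWComplex.cellFrontier_subset_finite_openCell (C := K) (k + 1 + 1) y
  -- the `(k + 1)`-cells that stay away from `p`
  set A : Set X := ⋃ j ∈ I (k + 1), ⋃ (_ : p ∉ closedCell (C := K) (k + 1) j),
    closedCell (C := K) (k + 1) j with hA
  have hAc : IsClosed A := by
    refine isClosed_biUnion_finset fun j _ => ?_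
    by_cases h : p ∉ closedCell (C := K) (k + 1) j
    · simpa [h] using isClosed_closedCell
    · simp [h]
  have hpA : p ∉ A := by
    simp only [hA, mem_iUnion, not_exists]
    exact fun j _ h => h
  have hcover : ∀ q ∈ cellFrontier (C := K) (k + 1 + 1) y, q ∉ A →
      q ∉ closedCell (C := K) (k + 1) x →
      q ∈ ⋃ (l : ℕ) (_ : l < k + 1) (j ∈ I l), openCell (C := K) l j := by
    intro q hq hqA hqx
    have hq' := hI hq
    simp only [mem_iUnion] at hq' ⊢
    obtain ⟨l, hl, j, hj, hqj⟩ := hq'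
    rcases Nat.lt_succ_iff_lt_or_eq.1 hl with hl | rfl
    · exact ⟨l, hl, j, hj, hqj⟩
    · exfalso
      by_cases hpj : p ∈ closedCell (C := K) (k + 1) j
      · refine hcon j ?_ ?_ ?_
        · rintro rfl
          exact hqx (openCell_subset_closedCell _ _ hqj)
        · exact (hK.closedCell_subset_cellFrontier (hpf j (by omega) hpj) hpv).trans
            (cellFrontier_subset_closedCell _ _)
        · exact (hK.closedCell_subset_cellFrontier hq hqj).trans
            (cellFrontier_subset_closedCell _ _)
      · apply hqA
        simp only [hA, mem_iUnion]
        exact ⟨j, hj, hpj, openCell_subset_closedCell _ _ hqj⟩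
  obtain ⟨U, hU, hUeq⟩ := exists_isOpen_inter_sphere_eq (y := y) isOpen_univ hAc
  simp only [univ_inter] at hUeq
  have hmaps : MapsTo (map (C := K) (k + 1 + 1) y) (U ∩ sphere 0 1)
      (closedCell (C := K) (k + 1) x) := by
    by_contra hnm
    simp only [MapsTo, not_forall] at hnm
    obtain ⟨u, hu, hux⟩ := hnm
    obtain ⟨V, hV, hVeq⟩ := exists_isOpen_inter_sphere_eq (y := y) hU
      (isClosed_closedCell (C := K) (n := k + 1) (i := x))
    have hempty := hK.inter_sphere_eq_empty (y := y) I (k + 1) le_rfl V hV (by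
      intro a ha
      rw [hVeq] at ha
      obtain ⟨ha, hax⟩ := ha
      rw [hUeq] at ha
      exact hcover _ (mem_image_of_mem _ ha.1) ha.2 hax)
    rw [hVeq] at hempty
    exact eq_empty_iff_forall_notMem.1 hempty u ⟨hu, hux⟩
  have hopen := isOpen_image_inter_sphere hU (hK.continuousOn_chart_map hmaps)
    (hK.injOn_chart_map hmaps)
  -- An open set inside the closed ball avoids its boundary, so the chart sends `p` into the open
  -- ball.
  have hsub := hopen.subset_interior_iff.2 (show _ ⊆ closedBall (0 : Fin (k + 1) → ℝ) 1 by
    rintro _ ⟨u, hu, rfl⟩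
    exact chart_mem (hmaps hu))
  rw [interior_closedBall _ one_ne_zero] at hsub
  have hu₀U : u₀ ∈ U ∩ sphere 0 1 := by
    rw [hUeq]
    exact ⟨hu₀, by rwa [hu₀p]⟩
  have hb := hsub (mem_image_of_mem _ hu₀U)
  rw [Function.comp_apply, hu₀p] at hb
  have := mem_image_of_mem (map (C := K) (k + 1) x) hb
  rw [map_chart hpx] at this
  exact hnot x (by omega) this

theorem IsRegularCW.exists_ne_between (hK : IsRegularCW K) {v x y : Cell K}
    (h₁ : x.dim = v.dim + 1) (h₂ : y.dim = x.dim + 1) (hvx : v ≤ x) (hxy : x ≤ y) :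
    ∃ x' : Cell K, x' ≠ x ∧ x'.dim = x.dim ∧ v ≤ x' ∧ x' ≤ y := by
  obtain ⟨k, v⟩ := v
  obtain ⟨d, x⟩ := x
  obtain ⟨d', y⟩ := y
  simp only at h₁ h₂
  subst h₁
  subst h₂
  obtain ⟨x', hne, hvx', hxy'⟩ := hK.exists_ne_between_aux v x y hvx hxy
  refine ⟨⟨k + 1, x'⟩, fun h => hne ?_, rfl, hvx', hxy'⟩
  cases h
  rfl

end RegularCW

end Topology

open CategoryTheory

/-! ### Reduction of walks -/

section WalkReduction

variable {α : Type u}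

open Classical in
/-- Prepend a vertex to a reduced walk, cancelling a repetition or a step back. -/
noncomputable def pushWalk (a : α) : List α → List α
  | [] => [a]
  | b :: l => if a = b then b :: l else if l.head? = some a then l else a :: b :: l

/-- The reduction of a walk: repetitions `a, a` and detours `a, b, a` are replaced by `a`. -/
noncomputable def reduceWalk (s : List α) : List α := s.foldr pushWalk []

/-- A walk without repetitions `a, a` and detours `a, b, a`. -/
def IsReduced : List α → Prop
  | [] => True
  | [_] => True
  | a :: b :: l => a ≠ b ∧ l.head? ≠ some a ∧ IsReduced (b :: l)

theorem IsReduced.tail {a : α} {l : List α} (h : IsReduced (a :: l)) : IsReduced l := by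
  cases l with
  | nil => trivial
  | cons b l => exact h.2.2

theorem pushWalk_eq_cons (a : α) (l : List α) : ∃ l', pushWalk a l = a :: l' := by
  cases l with
  | nil => exact ⟨[], rfl⟩
  | cons b l =>
    simp only [pushWalk]
    split_ifs with h1 h2
    · exact ⟨l, by rw [h1]⟩
    · cases l with
      | nil => simp at h2
      | cons c l =>
        simp only [List.head?_cons, Option.some.injEq] at h2
        exact ⟨l, by rw [h2]⟩
    · exact ⟨b :: l, rfl⟩

theorem IsReduced.pushWalk {l : List α} (h : IsReduced l) (a : α) : IsReduced (pushWalk a l) := by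
  cases l with
  | nil => trivial
  | cons b l =>
    simp only [DiscreteFlow.pushWalk]
    split_ifs with h1 h2
    · exact h
    · exact h.tail
    · exact ⟨h1, h2, h⟩

theorem pushWalk_self (a : α) (l : List α) : pushWalk a (pushWalk a l) = pushWalk a l := by
  obtain ⟨l', h⟩ := pushWalk_eq_cons a l
  rw [h]
  simp [pushWalk]

/-- Either `b` is put in front and the second `a` cancels it, or `b` cancels the first `a` and the
second `a` restores it. In the latter case reducedness rules out a further cancellation. -/
theorem pushWalk_pushWalk_pushWalk {l : List α} (hl : IsReduced l) (a b : α) :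
    pushWalk a (pushWalk b (pushWalk a l)) = pushWalk a l := by
  obtain ⟨m, h⟩ := pushWalk_eq_cons a l
  have hm := hl.pushWalk a
  rw [h] at hm ⊢
  by_cases hba : b = a
  · subst hba
    simp [pushWalk]
  cases m with
  | nil => simp [pushWalk, hba, Ne.symm hba]
  | cons c m =>
    by_cases hcb : c = b
    · subst hcb
      simp [pushWalk, hm.1, hm.2.1, Ne.symm hm.1]
    · simp [pushWalk, hba, hcb, Ne.symm hba]

theorem reduceWalk_cons (a : α) (s : List α) : reduceWalk (a :: s) = pushWalk a (reduceWalk s) :=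
  rfl

theorem reduceWalk_append_congr (s : List α) {t t' : List α} (h : reduceWalk t = reduceWalk t') :
    reduceWalk (s ++ t) = reduceWalk (s ++ t') := by
  induction s with
  | nil => exact h
  | cons a s ih => rw [List.cons_append, List.cons_append, reduceWalk_cons, ih, reduceWalk_cons]

theorem isReduced_reduceWalk (s : List α) : IsReduced (reduceWalk s) := by
  induction s with
  | nil => trivial
  | cons a s ih => exact ih.pushWalk a

theorem reduceWalk_cons_cons_self (a : α) (s : List α) :
    reduceWalk (a :: a :: s) = reduceWalk (a :: s) :=
  pushWalk_self _ _

theorem reduceWalk_cons_cons_cons (a b : α) (s : List α) :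
    reduceWalk (a :: b :: a :: s) = reduceWalk (a :: s) :=
  pushWalk_pushWalk_pushWalk (isReduced_reduceWalk s) a b

theorem reduceWalk_eq_self {s : List α} (h : IsReduced s) : reduceWalk s = s := by
  induction s with
  | nil => rfl
  | cons a s ih =>
    rw [reduceWalk_cons, ih h.tail]
    cases s with
    | nil => rfl
    | cons b s => simp [pushWalk, h.1, h.2.1]

theorem isReduced_of_nodup {s : List α} (h : s.Nodup) : IsReduced s := by
  induction s with
  | nil => trivial
  | cons a s ih =>
    cases s with
    | nil => trivial
    | cons b s =>
      rw [List.nodup_cons] at h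
      refine ⟨fun hab => h.1 (by simp [hab]), fun hs => h.1 ?_, ih h.2⟩
      exact List.mem_cons_of_mem _ (List.mem_of_mem_head? hs)

end WalkReduction

/-! ### Composition with arrows and formal inverses in the localization -/

section LocHomOperations

variable {C : Type u} [PCategory.{v} C] {S : MorphismProperty C}

theorem Zigzag.precomp_comp {x y y' z : C} (g : x ⟶ y) (h : y ⟶ y') (ζ : Zigzag S y' z) :
    ζ.precomp (g ≫ h) = (ζ.precomp h).precomp g := by
  cases ζ <;> simp [Zigzag.precomp]

theorem Zigzag.precomp_id {x z : C} (ζ : Zigzag S x z) : ζ.precomp (𝟙 x) = ζ := by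
  cases ζ <;> simp [Zigzag.precomp]

theorem Horizontal.precomp {x y z : C} (g : x ⟶ y) {ζ ζ' : Zigzag S y z} (h : Horizontal ζ ζ') :
    Horizontal (ζ.precomp g) (ζ'.precomp g) := by
  cases h with
  | remove g' ζ =>
    rw [← Zigzag.precomp_comp]
    exact .remove _ _
  | cons g' f hf h => exact .cons _ f hf h

/-- A relation between parallel morphisms that is reflexive, transitive and compatible with
composition. -/
structure IsCompatible (R : HomRel C) : Prop where
  refl {x y : C} (a : x ⟶ y) : R a a
  trans {x y : C} {a b c : x ⟶ y} : R a b → R b c → R a c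
  comp_left {x y z : C} (g : x ⟶ y) {a b : y ⟶ z} : R a b → R (g ≫ a) (g ≫ b)
  comp_right {x y z : C} {a b : x ⟶ y} (g : y ⟶ z) : R a b → R (a ≫ g) (b ≫ g)

theorem isCompatible_eq : IsCompatible (C := C) (fun _ _ a b => a = b) where
  refl _ := rfl
  trans := Eq.trans
  comp_left _ _ _ h := by rw [h]
  comp_right _ h := by rw [h]

theorem isCompatible_le : IsCompatible (C := C) (fun _ _ a b => a ≤ b) where
  refl _ := le_rfl
  trans := le_trans
  comp_left _ _ _ h := PCategory.comp_le_comp le_rfl h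
  comp_right _ h := PCategory.comp_le_comp h le_rfl

theorem Ladder.refl {R : HomRel C} (hR : IsCompatible R) {x z : C} (ζ : Zigzag S x z) :
    Ladder R (𝟙 x) ζ ζ := by
  induction ζ with
  | single g => exact .single _ (.id _) g g (by simpa using hR.refl g)
  | cons g f hf ζ ih =>
    exact .cons _ (.id _) (𝟙 _) (.id _) (𝟙 _) g g f hf f hf ζ ζ (by simpa using hR.refl g)
      (by simpa using hR.refl f) ih

theorem Ladder.precomp {R : HomRel C} (hR : IsCompatible R) {a a' x x' z : C} {v : x ⟶ x'}
    {ζ : Zigzag S x z} {ζ' : Zigzag S x' z} (h : Ladder R v ζ ζ') (v₀ : a ⟶ a')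
    (hv₀ : Plus S v₀) (g : a ⟶ x) (g' : a' ⟶ x') (hg : R (v₀ ≫ g') (g ≫ v)) :
    Ladder R v₀ (ζ.precomp g) (ζ'.precomp g') := by
  cases h with
  | single _ hv h h' hh =>
    refine .single _ hv₀ _ _ (hR.trans ?_ (hR.comp_left g hh))
    simpa using hR.comp_right h' hg
  | cons _ hv u hu v₁ h h' f hf f' hf' ζ ζ' hh hf L =>
    refine .cons _ hv₀ u hu v₁ _ _ f _ f' _ ζ ζ' (hR.trans (b := g ≫ v ≫ h') ?_ ?_) hf L
    · simpa using hR.comp_right h' hg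
    · simpa using hR.comp_left g hh

/-- Precomposition with a morphism of the original category. -/
def LocHom.pre {x y z : C} (g : x ⟶ y) : LocHom S y z → LocHom S x z :=
  Quot.map (Zigzag.precomp g) (by
    rintro ζ ζ' (h | h)
    · exact Or.inl (h.precomp g)
    · exact Or.inr (Ladder.precomp isCompatible_eq h _ (.id _) g g (by simp)))

/-- Precomposition with the formal inverse of a morphism in `S` or of an identity. -/
def LocHom.back {x y z : C} (f : x ⟶ y) (hf : Plus S f) : LocHom S x z → LocHom S y z :=
  Quot.map (Zigzag.cons (𝟙 y) f hf) (by
    rintro ζ ζ' (h | h)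
    · exact Or.inl (.cons _ f hf h)
    · exact Or.inr (.cons _ (.id _) (𝟙 _) (.id _) (𝟙 _) _ _ f hf f hf ζ ζ' (by simp) (by simp) h))

namespace LocHom

theorem mk_eq_of_vertical {x z : C} {ζ ζ' : Zigzag S x z} (h : Vertical ζ ζ') :
    LocHom.mk ζ = LocHom.mk ζ' := Quot.sound (Or.inr h)

theorem mk_eq_of_horizontal {x z : C} {ζ ζ' : Zigzag S x z} (h : Horizontal ζ ζ') :
    LocHom.mk ζ = LocHom.mk ζ' := Quot.sound (Or.inl h)

theorem ind {x z : C} {p : LocHom S x z → Prop} (h : ∀ ζ, p (mk ζ)) (γ : LocHom S x z) : p γ :=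
  Quot.ind h γ

theorem pre_mk {x y z : C} (g : x ⟶ y) (ζ : Zigzag S y z) : pre g (mk ζ) = mk (ζ.precomp g) := rfl

theorem back_mk {x y z : C} (f : x ⟶ y) (hf : Plus S f) (ζ : Zigzag S x z) :
    back f hf (mk ζ) = mk (.cons (𝟙 y) f hf ζ) := rfl

theorem pre_id {x z : C} (γ : LocHom S x z) : pre (𝟙 x) γ = γ := by
  induction γ using LocHom.ind with
  | h ζ => rw [pre_mk, Zigzag.precomp_id]

theorem pre_comp {x y y' z : C} (g : x ⟶ y) (h : y ⟶ y') (γ : LocHom S y' z) :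
    pre (g ≫ h) γ = pre g (pre h γ) := by
  induction γ using LocHom.ind with
  | h ζ => rw [pre_mk, pre_mk, pre_mk, Zigzag.precomp_comp]

theorem mk_single {x z : C} (g : x ⟶ z) :
    (mk (.single g) : LocHom S x z) = pre g (mk (.single (𝟙 z))) := by
  rw [pre_mk, Zigzag.precomp, Category.comp_id]

/-- Every class is thus built by `pre` and `back` from an identity, and later arguments use only
these two operations. -/
theorem mk_cons {x y x' z : C} (g : x ⟶ y) (f : x' ⟶ y) (hf : Plus S f) (ζ : Zigzag S x' z) :
    mk (.cons g f hf ζ) = pre g (back f hf (mk ζ)) := by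
  rw [back_mk, pre_mk, Zigzag.precomp, Category.comp_id]

theorem back_id {x z : C} (γ : LocHom S x z) : back (𝟙 x) (.id x) γ = γ := by
  induction γ using LocHom.ind with
  | h ζ =>
    rw [back_mk, mk_eq_of_horizontal (.remove _ _), Zigzag.precomp_id]

/-- A vertical arrow `f` at the middle object turns the pair of identities into the pair `f`, `f`.
-/
theorem pre_back {x y z : C} (f : x ⟶ y) (hf : Plus S f) (γ : LocHom S x z) :
    pre f (back f hf γ) = γ := by
  conv_rhs => rw [← back_id γ]
  induction γ using LocHom.ind with
  | h ζ =>
    rw [back_mk, pre_mk, Zigzag.precomp, back_mk]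
    symm
    exact mk_eq_of_vertical (.cons _ (.id _) f hf (𝟙 _) _ _ _ _ _ _ ζ ζ (by simp) (by simp)
      (Ladder.refl isCompatible_eq ζ))

/-- Here `f` is the vertical arrow after the formal inverse, and is absorbed by the first arrow of
the remaining zigzag. -/
theorem back_pre {x y z : C} (f : x ⟶ y) (hf : Plus S f) (γ : LocHom S y z) :
    back f hf (pre f γ) = γ := by
  conv_rhs => rw [← back_id γ]
  induction γ using LocHom.ind with
  | h ζ =>
    rw [pre_mk, back_mk, back_mk]
    refine mk_eq_of_vertical (.cons _ (.id _) (𝟙 _) (.id _) f _ _ _ _ _ _ _ ζ (by simp) (by simp) ?_)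
    have := Ladder.precomp isCompatible_eq (Ladder.refl isCompatible_eq ζ) f hf f (𝟙 _) (by simp)
    rwa [Zigzag.precomp_id] at this

theorem pre_mono {x y z : C} {g g' : x ⟶ y} (hg : g' ≤ g) {γ γ' : LocHom S y z} (h : γ' ≤ γ) :
    pre g' γ' ≤ pre g γ := by
  obtain ⟨ζ, ζ', rfl, rfl, h⟩ := h
  exact ⟨_, _, rfl, rfl, Ladder.precomp isCompatible_le h _ (.id _) g g' (by simpa using hg)⟩

theorem back_mono {x y z : C} (f : x ⟶ y) (hf : Plus S f) {γ γ' : LocHom S x z} (h : γ' ≤ γ) :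
    back f hf γ' ≤ back f hf γ := by
  obtain ⟨ζ, ζ', rfl, rfl, h⟩ := h
  exact ⟨_, _, rfl, rfl, .cons _ (.id _) (𝟙 _) (.id _) (𝟙 _) _ _ f hf f hf ζ ζ' (by simp) (by simp) h⟩

theorem le_refl {x z : C} (γ : LocHom S x z) : γ ≤ γ := by
  induction γ using LocHom.ind with
  | h ζ => exact ⟨ζ, ζ, rfl, rfl, Ladder.refl isCompatible_le ζ⟩

end LocHom

end LocHomOperations

/-! ### Descending sequences and matchings by covering relations -/

section EntrancePaths

variable {P : Type u} [PartialOrder P]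

instance Ent.instPartialOrder : PartialOrder (Ent P) := inferInstanceAs (PartialOrder P)

namespace Ent

/-- The cells of a descending sequence after the first one. -/
def tail {x y : Ent P} (g : x ⟶ y) : List (Ent P) := EntrancePath.tail g

/-- The two-element sequence `a > b` as a morphism of the entrance path category. -/
def step {a b : Ent P} (h : b < a) : a ⟶ b :=
  (⟨[b], List.isChain_pair.2 h, rfl⟩ : EntrancePath (P := P) a b)

theorem tail_comp {x y z : Ent P} (g : x ⟶ y) (h : y ⟶ z) : tail (g ≫ h) = tail g ++ tail h := rfl

theorem tail_id (x : Ent P) : tail (𝟙 x) = [] := rfl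

theorem tail_step {a b : Ent P} (h : b < a) : tail (step h) = [b] := rfl

theorem r_eq {x y : Ent P} (g : x ⟶ y) : EntrancePath.r g = (tail g).length := rfl

theorem r_step {a b : Ent P} (h : b < a) : EntrancePath.r (step h) = 1 := rfl

theorem hom_ext {x y : Ent P} {g h : x ⟶ y} (e : tail g = tail h) : g = h :=
  EntrancePath.ext e

theorem le_iff {x y : Ent P} {g h : x ⟶ y} : g ≤ h ↔ (tail g).Sublist (tail h) :=
  List.cons_sublist_cons

theorem hom_induction {motive : ∀ {x y : Ent P}, (x ⟶ y) → Prop}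
    (id : ∀ x : Ent P, motive (𝟙 x))
    (step_comp : ∀ {a b y : Ent P} (h : b < a) (g : b ⟶ y), motive g → motive (step h ≫ g))
    {x y : Ent P} (g : x ⟶ y) : motive g := by
  obtain ⟨t, hc, hl⟩ := g
  induction t generalizing x with
  | nil =>
    have hl' : x = y := hl
    subst hl'
    exact id x
  | cons b t ih =>
    have hc' := List.isChain_cons_cons.1 hc
    exact step_comp (b := b) hc'.1 (⟨t, hc'.2, hl⟩ : EntrancePath (P := P) b y) (ih hc'.2 hl)

theorem eq_of_tail_eq_nil {x y : Ent P} (g : x ⟶ y) (h : tail g = []) : x = y := by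
  induction g using hom_induction with
  | id => rfl
  | step_comp h' g => simp [tail_comp, tail_step] at h

theorem lt_of_tail_ne_nil {x y : Ent P} (g : x ⟶ y) (h : tail g ≠ []) : y < x := by
  induction g using hom_induction with
  | id => exact absurd rfl h
  | @step_comp a b y hba g ih =>
    by_cases hg : tail g = []
    · rw [← eq_of_tail_eq_nil g hg]
      exact hba
    · exact (ih hg).trans hba

/-- A sequence with at most one step is minimal. -/
theorem eq_of_le_of_r_le_one {x y : Ent P} {g h : x ⟶ y} (hgh : g ≤ h)
    (hr : EntrancePath.r h ≤ 1) : g = h := by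
  rw [le_iff] at hgh
  rw [r_eq] at hr
  apply hom_ext
  refine hgh.eq_of_length_le ?_
  by_contra hlt
  rw [not_le] at hlt
  have h1 : tail g = [] := by
    rw [← List.length_eq_zero_iff]
    omega
  have h2 : tail h ≠ [] := by
    intro h2
    rw [h1, h2] at hlt
    exact Nat.lt_irrefl _ hlt
  have h3 := lt_of_tail_ne_nil h h2
  rw [eq_of_tail_eq_nil g h1] at h3
  exact lt_irrefl _ h3

theorem cons_tail_eq {x y : Ent P} (g : x ⟶ y) : ∃ l, x :: tail g = l ++ [y] := by
  induction g using hom_induction with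
  | id x => exact ⟨[], rfl⟩
  | @step_comp a b y h g ih =>
    obtain ⟨l, hl⟩ := ih
    exact ⟨a :: l, by rw [tail_comp, tail_step, List.cons_append (as := l), ← hl]; rfl⟩

end Ent

/-- `S` consists of the sequences `(b > a)` with `M a b`, and the pairs `a < b` with `M a b` form a
partial matching by covering relations. -/
structure IsCoverMatching (S : MorphismProperty (Ent P)) (M : Ent P → Ent P → Prop) : Prop where
  mem_iff {x y : Ent P} (g : y ⟶ x) : S g ↔ M x y ∧ Ent.tail g = [x]
  lt {a b : Ent P} : M a b → a < b
  not_lt {a b c : Ent P} : M a b → a < c → ¬ c < b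
  right_unique {a b c : Ent P} : M a b → M a c → b = c
  left_unique {a b c : Ent P} : M a c → M b c → a = b
  not_chain {a b c : Ent P} : M a b → ¬ M b c

variable {S : MorphismProperty (Ent P)} {M : Ent P → Ent P → Prop}

namespace IsCoverMatching

theorem plus_step (hM : IsCoverMatching S M) {a b : Ent P} (h : a < b) (hm : M a b) :
    Plus S (Ent.step h) := .of _ ((hM.mem_iff _).2 ⟨hm, rfl⟩)

theorem tail_eq (hM : IsCoverMatching S M) {x y : Ent P} {f : x ⟶ y} (hf : Plus S f) :
    Ent.tail f = [] ∨ (M y x ∧ Ent.tail f = [y]) := by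
  cases hf with
  | of f hf => exact Or.inr ((hM.mem_iff f).1 hf)
  | id => exact Or.inl rfl

theorem r_comp_le_one (hM : IsCoverMatching S M) {x y z : Ent P} {f : x ⟶ y} {g : y ⟶ z}
    (hf : Plus S f) (hg : Plus S g) : EntrancePath.r (f ≫ g) ≤ 1 := by
  rw [Ent.r_eq, Ent.tail_comp]
  rcases hM.tail_eq hf with h1 | ⟨m1, h1⟩ <;> rcases hM.tail_eq hg with h2 | ⟨m2, h2⟩ <;>
    rw [h1, h2]
  · simp
  · simp
  · simp
  · exact absurd m1 (hM.not_chain m2)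

end IsCoverMatching

/-! ### The reduced walk as an invariant of the class -/

section NormalForm

/-- The concatenation of the right-pointing arrows of a zigzag. -/
def Zigzag.walk {x z : Ent P} (ζ : Zigzag S x z) : List (Ent P) := ζ.toSeq

theorem Zigzag.walk_single {x z : Ent P} (g : x ⟶ z) :
    (Zigzag.single g : Zigzag S x z).walk = x :: Ent.tail g := rfl

theorem Zigzag.walk_cons {x y x' z : Ent P} (g : x ⟶ y) (f : x' ⟶ y) (hf : Plus S f)
    (ζ : Zigzag S x' z) : (Zigzag.cons g f hf ζ).walk = x :: (Ent.tail g ++ ζ.walk) := rfl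

theorem Zigzag.walk_eq {x z : Ent P} (ζ : Zigzag S x z) : ∃ l, ζ.walk = x :: l := by
  cases ζ with
  | single g => exact ⟨_, rfl⟩
  | cons g f hf ζ => exact ⟨_, rfl⟩

theorem Zigzag.walk_precomp {x y z : Ent P} (g : x ⟶ y) (ζ : Zigzag S y z) :
    (ζ.precomp g).walk = x :: (Ent.tail g ++ ζ.walk.tail) := by
  cases ζ with
  | single h => rfl
  | cons h f hf ζ =>
    rw [Zigzag.precomp, Zigzag.walk_cons, Zigzag.walk_cons, Ent.tail_comp, List.tail_cons,
      List.append_assoc]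

theorem reduceWalk_cons_tail_append {x y : Ent P} (g : x ⟶ y) (t : List (Ent P)) :
    reduceWalk (x :: (Ent.tail g ++ y :: t)) = reduceWalk (x :: (Ent.tail g ++ t)) := by
  obtain ⟨l, hl⟩ := Ent.cons_tail_eq g
  rw [← List.cons_append, ← List.cons_append, hl, List.append_assoc, List.append_assoc]
  exact reduceWalk_append_congr l (reduceWalk_cons_cons_self _ _)

theorem reduceWalk_cons_tail_append_congr {x y : Ent P} (g : x ⟶ y) {t t' : List (Ent P)}
    (h : reduceWalk (y :: t) = reduceWalk (y :: t')) :
    reduceWalk (x :: (Ent.tail g ++ t)) = reduceWalk (x :: (Ent.tail g ++ t')) := by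
  obtain ⟨l, hl⟩ := Ent.cons_tail_eq g
  rw [← List.cons_append, ← List.cons_append, hl, List.append_assoc, List.append_assoc]
  exact reduceWalk_append_congr l h

theorem reduceWalk_walk_of_horizontal {x z : Ent P} {ζ ζ' : Zigzag S x z} (h : Horizontal ζ ζ') :
    reduceWalk ζ.walk = reduceWalk ζ'.walk := by
  induction h with
  | remove g ζ =>
    obtain ⟨t, ht⟩ := ζ.walk_eq
    rw [Zigzag.walk_precomp, Zigzag.walk_cons, ht, reduceWalk_cons_tail_append, List.tail_cons]
  | @cons x y x' z g f hf ζ ζ' h ih =>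
    rw [Zigzag.walk_cons, Zigzag.walk_cons]
    exact reduceWalk_append_congr (x :: Ent.tail g) ih

/-- In a commutative square of morphisms in `S⁺`, the two ways from the upper right corner `y` to
the lower left corner `x'` have the same reduction. -/
theorem IsCoverMatching.reduceWalk_square (hM : IsCoverMatching S M) {x x' y y' : Ent P}
    {u : y ⟶ y'} {w : x ⟶ x'} {f : x ⟶ y} {f' : x' ⟶ y'} (hu : Plus S u) (hf : Plus S f)
    (h : w ≫ f' = f ≫ u) (t : List (Ent P)) :
    reduceWalk (y :: (Ent.tail u ++ x' :: t)) =
      reduceWalk (y :: x :: (Ent.tail w ++ x' :: t)) := by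
  have ht := congrArg Ent.tail h
  rw [Ent.tail_comp, Ent.tail_comp] at ht
  have hw := Ent.eq_of_tail_eq_nil w
  have hf' := Ent.eq_of_tail_eq_nil f'
  -- Matched pairs do not chain, so each composite has at most one step. The two routes then differ
  -- only by a repetition or one detour.
  rcases hM.tail_eq hu with h1 | ⟨m1, h1⟩ <;> rcases hM.tail_eq hf with h2 | ⟨m2, h2⟩
  · rw [h1, h2] at ht
    obtain ⟨h3, -⟩ := List.append_eq_nil_iff.1 ht
    have e1 := hw h3
    have e2 := Ent.eq_of_tail_eq_nil f h2
    rw [h1, h3, ← e1, ← e2]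
    simp [reduceWalk_cons_cons_self]
  · rw [h1, h2] at ht
    rw [h1]
    rcases List.append_eq_singleton_iff.1 ht with ⟨h3, -⟩ | ⟨h3, h4⟩
    · rw [h3, ← hw h3, List.nil_append, reduceWalk_cons, reduceWalk_cons y,
        reduceWalk_cons_cons_self]
    · rw [h3, hf' h4, ← Ent.eq_of_tail_eq_nil u h1]
      simp only [List.nil_append, List.cons_append]
      rw [reduceWalk_cons_cons_cons, reduceWalk_cons_cons_self]
  · rw [h1, h2] at ht
    have e2 := Ent.eq_of_tail_eq_nil f h2
    subst e2
    rw [h1, reduceWalk_cons_cons_self]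
    rcases List.append_eq_singleton_iff.1 ht with ⟨h3, -⟩ | ⟨h3, h4⟩
    · rw [h3, ← hw h3]
      simp only [List.nil_append, List.cons_append]
      rw [reduceWalk_cons_cons_cons, reduceWalk_cons_cons_self]
    · rw [h3]
  · exact absurd m2 (hM.not_chain m1)

/-- The prefix `v` is what makes the induction work: it is carried across one square after another.
-/
theorem IsCoverMatching.reduceWalk_walk_of_ladder (hM : IsCoverMatching S M) {x x' z : Ent P}
    {v : x ⟶ x'} {ζ : Zigzag S x z} {ζ' : Zigzag S x' z}
    (h : Ladder (fun _ _ a b => a = b) v ζ ζ') :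
    reduceWalk (x :: (Ent.tail v ++ ζ'.walk)) = reduceWalk ζ.walk := by
  induction h with
  | single v hv g g' h =>
    rw [Zigzag.walk_single, Zigzag.walk_single, reduceWalk_cons_tail_append, ← Ent.tail_comp, h]
  | @cons x x' y y' x₁ x₁' z v hv u hu v₁ g g' f hf f' hf' ζ ζ' hg hR h ih =>
    obtain ⟨t, ht⟩ := ζ'.walk_eq
    rw [Zigzag.walk_cons, Zigzag.walk_cons, reduceWalk_cons_tail_append, ← List.append_assoc,
      ← Ent.tail_comp, hg, Ent.tail_comp, List.append_assoc]
    refine reduceWalk_cons_tail_append_congr g ?_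
    rw [ht] at ih ⊢
    rw [hM.reduceWalk_square hu hf hR, reduceWalk_cons, ih, reduceWalk_cons]

namespace LocHom

/-- The reduced walk of a morphism of the localization. -/
noncomputable def nf (hM : IsCoverMatching S M) {x z : Ent P} (γ : LocHom S x z) : List (Ent P) :=
  Quot.lift (fun ζ => reduceWalk ζ.walk) (by
    rintro ζ ζ' (h | h)
    · exact reduceWalk_walk_of_horizontal h
    · obtain ⟨t, ht⟩ := ζ'.walk_eq
      have := hM.reduceWalk_walk_of_ladder h
      rw [Ent.tail_id, List.nil_append, ht, reduceWalk_cons_cons_self] at this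
      exact ((congrArg reduceWalk ht).trans this).symm) γ

variable (hM : IsCoverMatching S M)

theorem nf_mk {x z : Ent P} (ζ : Zigzag S x z) : nf hM (mk ζ) = reduceWalk ζ.walk := rfl

theorem isReduced_nf {x z : Ent P} (γ : LocHom S x z) : IsReduced (nf hM γ) := by
  induction γ using LocHom.ind with
  | h ζ => exact isReduced_reduceWalk _

theorem nf_pre_step {a b z : Ent P} (h : b < a) (γ : LocHom S b z) :
    nf hM (pre (Ent.step h) γ) = pushWalk a (nf hM γ) := by
  induction γ using LocHom.ind with
  | h ζ =>
    obtain ⟨t, ht⟩ := ζ.walk_eq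
    rw [pre_mk, nf_mk, nf_mk, Zigzag.walk_precomp, ht]
    rfl

theorem nf_back {x y z : Ent P} (f : x ⟶ y) (hf : Plus S f) (γ : LocHom S x z) :
    nf hM (back f hf γ) = pushWalk y (nf hM γ) := by
  induction γ using LocHom.ind with
  | h ζ => rfl

theorem rankSum_pre {x y z : Ent P} (g : x ⟶ y) (γ : LocHom S y z) :
    (pre g γ).rankSum = γ.rankSum - EntrancePath.r g := by
  induction γ using LocHom.ind with
  | h ζ => exact rankSum_precomp g ζ

theorem rankSum_back {x y z : Ent P} (f : x ⟶ y) (hf : Plus S f) (γ : LocHom S x z) :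
    (back f hf γ).rankSum = EntrancePath.r f + γ.rankSum := by
  induction γ using LocHom.ind with
  | h ζ =>
    change (EntrancePath.r f : ℤ) - (EntrancePath.r (𝟙 y) : ℤ) + ζ.rankSum =
      EntrancePath.r f + ζ.rankSum
    rw [r_id]
    simp

end LocHom

end NormalForm

/-! ### Reconstructing a morphism from its reduced walk -/

section Walk

open LocHom

/-- `IsWalk hM s γ`: the class `γ` is the composite of the steps of the walk `s`, each of which
goes down in the poset or up along a matched pair. -/
inductive IsWalk (hM : IsCoverMatching S M) {z : Ent P} :
    ∀ {x : Ent P}, List (Ent P) → LocHom S x z → Prop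
  | nil : IsWalk hM [z] (mk (.single (𝟙 z)))
  | down {a b : Ent P} {l : List (Ent P)} {γ : LocHom S b z} (h : b < a)
      (W : IsWalk hM (b :: l) γ) : IsWalk hM (a :: b :: l) (pre (Ent.step h) γ)
  | up {a b : Ent P} {l : List (Ent P)} {γ : LocHom S b z} (h : a < b) (hm : M a b)
      (W : IsWalk hM (b :: l) γ) :
      IsWalk hM (a :: b :: l) (back (Ent.step h) (hM.plus_step h hm) γ)

variable {hM : IsCoverMatching S M}

namespace IsWalk

theorem head?_eq {x z : Ent P} {s : List (Ent P)} {γ : LocHom S x z} (W : IsWalk hM s γ) :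
    s.head? = some x := by
  cases W <;> rfl

theorem getLast?_eq {x z : Ent P} {s : List (Ent P)} {γ : LocHom S x z} (W : IsWalk hM s γ) :
    s.getLast? = some z := by
  induction W with
  | nil => rfl
  | down h W ih => rwa [List.getLast?_cons_cons]
  | up h hm W ih => rwa [List.getLast?_cons_cons]

theorem isChain {x z : Ent P} {s : List (Ent P)} {γ : LocHom S x z} (W : IsWalk hM s γ) :
    s.IsChain (fun a b => b < a ∨ M a b) := by
  induction W with
  | nil => simp
  | down h W ih => exact List.isChain_cons_cons.2 ⟨Or.inl h, ih⟩
  | up h hm W ih => exact List.isChain_cons_cons.2 ⟨Or.inr hm, ih⟩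

/-- After the descent from `a`, the walk can return at once only by an upward step, and `pre_back`
cancels the two. -/
theorem pushWalk_pre {a b z : Ent P} {s : List (Ent P)} {γ : LocHom S b z} (h : b < a)
    (W : IsWalk hM s γ) : IsWalk hM (pushWalk a s) (pre (Ent.step h) γ) := by
  cases W with
  | nil => simpa [pushWalk, h.ne'] using IsWalk.down h .nil
  | @down _ c l γ h' W =>
    have : a ≠ c := (h'.trans h).ne'
    simpa [pushWalk, h.ne', this.symm] using IsWalk.down h (.down h' W)
  | @up _ c l γ h' hm W =>
    by_cases hc : c = a
    · subst hc
      rw [pre_back]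
      simpa [pushWalk, h.ne'] using W
    · simpa [pushWalk, h.ne', hc] using IsWalk.down h (.up h' hm W)

/-- Two upward steps in a row would chain matched pairs. So an immediate return is a descent, and
`back_pre` cancels it. -/
theorem pushWalk_back {a b z : Ent P} {s : List (Ent P)} {γ : LocHom S b z} (h : a < b)
    (hm : M a b) (W : IsWalk hM s γ) :
    IsWalk hM (pushWalk a s) (back (Ent.step h) (hM.plus_step h hm) γ) := by
  cases W with
  | nil => simpa [pushWalk, h.ne] using IsWalk.up h hm .nil
  | @down _ c l γ h' W =>
    by_cases hc : c = a
    · subst hc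
      rw [back_pre]
      simpa [pushWalk, h.ne] using W
    · simpa [pushWalk, h.ne, hc] using IsWalk.up h hm (.down h' W)
  | @up _ c l γ h' hm' W => exact absurd hm' (hM.not_chain hm)

theorem exists_zigzag {x z : Ent P} {s : List (Ent P)} {γ : LocHom S x z} (W : IsWalk hM s γ) :
    ∃ ζ : Zigzag S x z, mk ζ = γ ∧ ζ.walk = s := by
  induction W with
  | nil => exact ⟨_, rfl, rfl⟩
  | @down a b l γ h W ih =>
    obtain ⟨ζ, rfl, hζ⟩ := ih
    exact ⟨ζ.precomp (Ent.step h), rfl, by rw [Zigzag.walk_precomp, hζ]; rfl⟩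
  | @up a b l γ h hm W ih =>
    obtain ⟨ζ, rfl, hζ⟩ := ih
    exact ⟨.cons (𝟙 a) (Ent.step h) (hM.plus_step h hm) ζ, rfl, by
      rw [Zigzag.walk_cons, hζ]; rfl⟩

/-- The order of two consecutive cells tells whether the step is an arrow or a formal inverse. -/
theorem unique {x z : Ent P} {s : List (Ent P)} {γ γ' : LocHom S x z} (W : IsWalk hM s γ)
    (W' : IsWalk hM s γ') : γ = γ' := by
  induction W with
  | nil => cases W'; rfl
  | down h W ih =>
    cases W' with
    | down h' W' => rw [ih W']
    | up h' hm W' => exact absurd h (lt_asymm h')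
  | up h hm W ih =>
    cases W' with
    | down h' W' => exact absurd h (lt_asymm h')
    | up h' hm W' => rw [ih W']

end IsWalk

theorem LocHom.isWalk_nf_pre {x y z : Ent P} (g : x ⟶ y) :
    ∀ γ : LocHom S y z, IsWalk hM (nf hM γ) γ → IsWalk hM (nf hM (pre g γ)) (pre g γ) := by
  induction g using Ent.hom_induction with
  | id x => exact fun γ W => by rwa [pre_id]
  | step_comp h g ih =>
    intro γ W
    rw [pre_comp, nf_pre_step]
    exact (ih γ W).pushWalk_pre h

/-- Each morphism of the localization is the composite of its reduced walk. -/
theorem LocHom.isWalk_nf {x z : Ent P} (γ : LocHom S x z) : IsWalk hM (nf hM γ) γ := by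
  induction γ using LocHom.ind with
  | h ζ =>
    induction ζ with
    | single g =>
      rw [mk_single]
      exact isWalk_nf_pre g _ .nil
    | @cons x y x' z g f hf ζ ih =>
      rw [mk_cons]
      apply isWalk_nf_pre
      cases hf with
      | id => rwa [back_id]
      | of f hf =>
        obtain ⟨hm, ht⟩ := (hM.mem_iff f).1 hf
        have hlt := hM.lt hm
        have hf' : f = Ent.step hlt := Ent.hom_ext ht
        subst hf'
        rw [nf_back]
        exact ih.pushWalk_back hlt hm

end Walk

end EntrancePaths

/-! ### Potentials exclude repeated cells -/

section Potential

variable {P : Type u} [PartialOrder P] {S : MorphismProperty (Ent P)}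
  {M : Ent P → Ent P → Prop}

/-- A potential that is constant on matched pairs and strictly decreasing along all other
descending steps. -/
structure IsPotential {β : Type*} [LinearOrder β] (M : Ent P → Ent P → Prop) (φ : Ent P → β) :
    Prop where
  eq {a b : Ent P} : M a b → φ a = φ b
  lt {a b : Ent P} : b < a → ¬ M b a → φ b < φ a

/-- A reduced walk does not visit a vertex twice if there is a potential. -/
theorem IsPotential.nodup {β : Type*} [LinearOrder β] {φ : Ent P → β} (hφ : IsPotential M φ)
    (hM : IsCoverMatching S M) {s : List (Ent P)} (hs : s.IsChain fun a b => b < a ∨ M a b)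
    (hr : IsReduced s) : s.Nodup := by
  have hstep : ∀ a b : Ent P, b < a ∨ M a b → φ b < φ a ∨ (φ b = φ a ∧ (M a b ∨ M b a)) := by
    rintro a b (h | h)
    · by_cases hm : M b a
      · exact Or.inr ⟨hφ.eq hm, Or.inr hm⟩
      · exact Or.inl (hφ.lt h hm)
    · exact Or.inr ⟨(hφ.eq h).symm, Or.inl h⟩
  have hle : ∀ (l : List (Ent P)) (a : Ent P), (a :: l).IsChain (fun a b => b < a ∨ M a b) →
      ∀ c ∈ l, φ c ≤ φ a := by
    intro l
    induction l with
    | nil => simp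
    | cons b l ih =>
      intro a h c hc
      rw [List.isChain_cons_cons] at h
      have hba : φ b ≤ φ a := (hstep a b h.1).elim le_of_lt fun h => h.1.le
      rcases List.mem_cons.1 hc with rfl | hc
      · exact hba
      · exact (ih b h.2 c hc).trans hba
  induction s with
  | nil => simp
  | cons a s ih =>
    rw [List.nodup_cons]
    refine ⟨?_, ih hs.tail hr.tail⟩
    cases s with
    | nil => simp
    | cons b s =>
      rw [List.isChain_cons_cons] at hs
      rintro hmem
      rcases List.mem_cons.1 hmem with h | hmem
      · exact hr.1 h
      cases s with
      | nil => simp at hmem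
      | cons c s =>
        have hbc := List.isChain_cons_cons.1 hs.2
        have h1 : φ a ≤ φ c := by
          rcases List.mem_cons.1 hmem with rfl | hmem
          · exact le_rfl
          · exact hle s c hbc.2 a hmem
        have hac : a ≠ c := fun h => hr.2.1 (by simp [h])
        -- Since `a` recurs, the potential cannot drop on the first two steps. Both are then matched
        -- pairs through `b`, which forces `a = c`.
        rcases hstep a b hs.1 with h2 | ⟨h2, h3⟩
        · rcases hstep b c hbc.1 with h4 | ⟨h4, -⟩ <;> order
        · rcases hstep b c hbc.1 with h4 | ⟨-, h4⟩
          · order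
          · rcases h3 with h3 | h3 <;> rcases h4 with h4 | h4
            · exact hM.not_chain h3 h4
            · exact hac (hM.left_unique h3 h4)
            · exact hac (hM.right_unique h3 h4)
            · exact hM.not_chain h4 h3

/-! ### 2-cells, rank and the change of the reduced walk -/

section Order

open LocHom

/-- Removal of one element of a descending sequence, in the middle of a zigzag. -/
inductive OneStep (hM : IsCoverMatching S M) {z : Ent P} :
    ∀ {x : Ent P}, LocHom S x z → LocHom S x z → Prop
  | remove {p x q : Ent P} (hxp : x < p) (hqx : q < x) (δ : LocHom S q z) :
      OneStep hM (pre (Ent.step (hqx.trans hxp)) δ) (pre (Ent.step hxp) (pre (Ent.step hqx) δ))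
  | pre {a b : Ent P} {γ' γ : LocHom S b z} (h : b < a) (H : OneStep hM γ' γ) :
      OneStep hM (pre (Ent.step h) γ') (pre (Ent.step h) γ)
  | back {a b : Ent P} {γ' γ : LocHom S b z} (h : a < b) (hm : M a b) (H : OneStep hM γ' γ) :
      OneStep hM (back (Ent.step h) (hM.plus_step h hm) γ')
        (back (Ent.step h) (hM.plus_step h hm) γ)

variable {hM : IsCoverMatching S M}

theorem OneStep.pre_hom {x y z : Ent P} (g : x ⟶ y) :
    ∀ {γ' γ : LocHom S y z}, OneStep hM γ' γ → OneStep hM (LocHom.pre g γ') (LocHom.pre g γ) := by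
  induction g using Ent.hom_induction with
  | id x => exact fun H => by rwa [pre_id, pre_id]
  | step_comp h g ih =>
    intro γ' γ H
    rw [pre_comp, pre_comp]
    exact (ih H).pre h

theorem OneStep.back_plus {x y z : Ent P} (f : x ⟶ y) (hf : Plus S f) {γ' γ : LocHom S x z}
    (H : OneStep hM γ' γ) : OneStep hM (LocHom.back f hf γ') (LocHom.back f hf γ) := by
  cases hf with
  | id => rwa [back_id, back_id]
  | of f hf =>
    obtain ⟨hm, ht⟩ := (hM.mem_iff f).1 hf
    have hf' : f = Ent.step (hM.lt hm) := Ent.hom_ext ht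
    subst hf'
    exact H.back (hM.lt hm) hm

theorem r_le_of_le {x y : Ent P} {g' g : x ⟶ y} (h : g' ≤ g) :
    EntrancePath.r g' ≤ EntrancePath.r g :=
  (Ent.le_iff.1 h).length_le

theorem eq_of_le_of_r_eq {x y : Ent P} {g' g : x ⟶ y} (h : g' ≤ g)
    (hr : EntrancePath.r g = EntrancePath.r g') : g' = g :=
  Ent.hom_ext ((Ent.le_iff.1 h).eq_of_length hr.symm)

/-- Peel off common steps until the missing entry comes next. It has a successor, since both
sequences end at `y`. -/
theorem OneStep.of_le {x y z : Ent P} {g' g : x ⟶ y} (h : g' ≤ g)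
    (hr : EntrancePath.r g = EntrancePath.r g' + 1) (δ : LocHom S y z) :
    OneStep hM (LocHom.pre g' δ) (LocHom.pre g δ) := by
  induction g using Ent.hom_induction with
  | id x =>
    rw [r_id] at hr
    omega
  | @step_comp a b y hba g ih =>
    have hsub := Ent.le_iff.1 h
    rw [Ent.tail_comp, Ent.tail_step, List.singleton_append] at hsub
    rw [r_comp, Ent.r_step, Ent.r_eq, Ent.r_eq] at hr
    rcases List.sublist_cons_iff.1 hsub with hsub' | ⟨t, ht, hsub'⟩
    · -- the first element `b` is removed
      have ht : Ent.tail g' = Ent.tail g := hsub'.eq_of_length (by omega)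
      clear ih h hsub hsub'
      induction g using Ent.hom_induction with
      | id x => exact absurd (Ent.eq_of_tail_eq_nil g' ht).symm hba.ne
      | @step_comp b c y hcb g ih =>
        have hg' : g' = Ent.step (hcb.trans hba) ≫ g := Ent.hom_ext ht
        rw [hg', pre_comp, pre_comp, pre_comp]
        exact .remove hba hcb _
    · -- a later element is removed
      obtain ⟨k, hk, rfl⟩ : ∃ k : b ⟶ y, Ent.tail k = t ∧ g' = Ent.step hba ≫ k := by
        have hd := g'.descending
        have hl := g'.getLast_eq
        have ht' : EntrancePath.tail g' = b :: t := ht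
        rw [ht'] at hd
        have hl2 : (b :: t).getLast (List.cons_ne_nil _ _) = y := by
          simp only [ht'] at hl
          exact hl
        exact ⟨(⟨t, (List.isChain_cons_cons.1 hd).2, hl2⟩ : EntrancePath (P := P) b y), rfl,
          Ent.hom_ext ht⟩
      rw [pre_comp, pre_comp]
      refine (ih (g' := k) (Ent.le_iff.2 (hk ▸ hsub')) ?_ δ).pre hba
      rw [ht, ← hk, List.length_cons] at hr
      rw [Ent.r_eq, Ent.r_eq]
      omega

/-- Comparison of the rows of a ladder of 2-cells. -/
theorem IsCoverMatching.ladder_le (hM : IsCoverMatching S M) {x x' z : Ent P} {v : x ⟶ x'}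
    {ζ : Zigzag S x z} {ζ' : Zigzag S x' z} (L : Ladder (fun _ _ a b => a ≤ b) v ζ ζ') :
    ζ.rankSum + EntrancePath.r v ≤ ζ'.rankSum ∧
      (ζ'.rankSum = ζ.rankSum + EntrancePath.r v → LocHom.mk ζ = pre v (LocHom.mk ζ')) ∧
      (ζ'.rankSum = ζ.rankSum + EntrancePath.r v + 1 → OneStep hM (pre v (LocHom.mk ζ')) (LocHom.mk ζ)) := by
  induction L with
  | single v hv g g' h =>
    simp only [Zigzag.rankSum]
    have hr := r_le_of_le h
    rw [mk_single g, mk_single g', ← pre_comp]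
    refine ⟨?_, fun e => ?_, fun e => ?_⟩
    · rw [r_comp] at hr
      omega
    · rw [eq_of_le_of_r_eq h (by rw [r_comp]; omega)]
    · exact .of_le h (by rw [r_comp]; omega) _
  | cons v hv u hu v₁ g g' f hf f' hf' ζ ζ' hg hR L ih =>
    obtain ⟨ih1, ih2, ih3⟩ := ih
    have hr := r_le_of_le hg
    -- The upper composite has at most one step, so the 2-cell in a left-pointing square is an
    -- equality.
    have hsq : v₁ ≫ f' = f ≫ u := Ent.eq_of_le_of_r_le_one hR (hM.r_comp_le_one hf hu)
    have hrsq := congrArg EntrancePath.r hsq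
    rw [r_comp, r_comp] at hr hrsq
    simp only [Zigzag.rankSum]
    -- moving the vertical arrow `v₁` across the square of left-pointing arrows
    have hmove : back f hf (pre v₁ (LocHom.mk ζ')) = pre u (back f' hf' (LocHom.mk ζ')) := by
      conv_rhs => rw [← back_pre f hf (pre u _), ← pre_comp, ← hsq, pre_comp, pre_back]
    rw [mk_cons, mk_cons, ← pre_comp]
    refine ⟨by omega, fun e => ?_, fun e => ?_⟩
    · rw [ih2 (by omega), hmove, ← pre_comp,
        eq_of_le_of_r_eq hg (by rw [r_comp, r_comp]; omega)]
    -- The single missing cell lies either in the present square or in the rest of the ladder.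
    · by_cases hc : ζ'.rankSum = ζ.rankSum + EntrancePath.r v₁
      · rw [ih2 hc, hmove, ← pre_comp]
        exact .of_le hg (by rw [r_comp, r_comp]; omega) _
      · rw [eq_of_le_of_r_eq hg (by rw [r_comp, r_comp]; omega), pre_comp, ← hmove]
        exact ((ih3 (by omega)).back_plus f hf).pre_hom g

theorem LocHom.rankSum_le_of_le (hM : IsCoverMatching S M) {x z : Ent P} {γ' γ : LocHom S x z}
    (h : γ' ≤ γ) : γ.rankSum ≤ γ'.rankSum ∧ (γ'.rankSum = γ.rankSum → γ' = γ) ∧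
      (γ'.rankSum = γ.rankSum + 1 → OneStep hM γ' γ) := by
  obtain ⟨ζ, ζ', rfl, rfl, L⟩ := h
  obtain ⟨h1, h2, h3⟩ := hM.ladder_le L
  rw [r_id] at h1 h2 h3
  rw [pre_id] at h2 h3
  simp only [Nat.cast_zero, add_zero] at h1 h2 h3
  exact ⟨h1, fun e => (h2 e).symm, h3⟩

/-- The possible differences between the walks before and after the removal of one element of a
descending sequence. -/
inductive WalkDiff (M : Ent P → Ent P → Prop) : List (Ent P) → List (Ent P) → Prop
  | insert (l₁ l₂ : List (Ent P)) {p x q : Ent P} (hxp : x < p) (hqx : q < x) :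
      WalkDiff M (l₁ ++ p :: q :: l₂) (l₁ ++ p :: x :: q :: l₂)
  | eraseUpper (l₁ l₂ : List (Ent P)) {p x q : Ent P} (hpx : M p x) (hqx : q < x) (hqp : q < p) :
      WalkDiff M (l₁ ++ p :: x :: q :: l₂) (l₁ ++ p :: q :: l₂)
  | eraseLower (l₁ l₂ : List (Ent P)) {p x q : Ent P} (hxp : x < p) (hxq : M x q) (hqp : q < p) :
      WalkDiff M (l₁ ++ p :: x :: q :: l₂) (l₁ ++ p :: q :: l₂)

theorem WalkDiff.cons {s t : List (Ent P)} (h : WalkDiff M s t) (c : Ent P) :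
    WalkDiff M (c :: s) (c :: t) := by
  cases h with
  | insert l₁ l₂ hxp hqx => exact .insert (c :: l₁) l₂ hxp hqx
  | eraseUpper l₁ l₂ hpx hqx hqp => exact .eraseUpper (c :: l₁) l₂ hpx hqx hqp
  | eraseLower l₁ l₂ hxp hxq hqp => exact .eraseLower (c :: l₁) l₂ hxp hxq hqp

/-- Cancellation looks only at the first two cells. If the walks differ beyond them, both react
alike, so only an empty `l₁` needs separate treatment. -/
theorem WalkDiff.pushWalk_append (l₁ : List (Ent P)) {p c b : Ent P} {s t : List (Ent P)}
    (hd : ∀ l, WalkDiff M (l ++ p :: s) (l ++ p :: t))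
    (h0 : p = b → WalkDiff M (pushWalk c (p :: s)) (pushWalk c (p :: t)))
    (hb : (l₁ ++ p :: s).head? = some b) (hcb : c ≠ b) :
    WalkDiff M (pushWalk c (l₁ ++ p :: s)) (pushWalk c (l₁ ++ p :: t)) := by
  cases l₁ with
  | nil => exact h0 (by simpa using hb)
  | cons e l₁ =>
    simp only [List.cons_append, List.head?_cons, Option.some.injEq] at hb
    subst hb
    have hh : (l₁ ++ p :: s).head? = (l₁ ++ p :: t).head? := by cases l₁ <;> rfl
    by_cases hc : (l₁ ++ p :: t).head? = some c
    · simpa only [List.cons_append, pushWalk, hcb, if_false, hh, hc, if_true] using hd l₁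
    · simpa only [List.cons_append, pushWalk, hcb, if_false, hh, hc] using hd (c :: e :: l₁)

/-- Prepending a step to two walks preserves the relation between their reductions. -/
theorem WalkDiff.pushWalk (hM : IsCoverMatching S M) {s t : List (Ent P)} (h : WalkDiff M s t)
    {b c : Ent P} (hb : s.head? = some b) (hcb : b < c ∨ M c b) :
    WalkDiff M (pushWalk c s) (pushWalk c t) := by
  have hne : c ≠ b := hcb.elim (fun h => h.ne') fun h => (hM.lt h).ne
  cases h with
  | @insert l₁ l₂ p x q hxp hqx =>
    refine pushWalk_append l₁ (fun l => .insert l l₂ hxp hqx) ?_ hb hne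
    rintro rfl
    -- If `c = q`, then `x` would lie strictly between the matched cells `c` and `p`. This is where
    -- covering is used.
    have hcq : q ≠ c := by
      rintro rfl
      rcases hcb with h | h
      · exact lt_asymm h (hqx.trans hxp)
      · exact hM.not_lt h hqx hxp
    -- If `c = x`, the longer walk `x, p, x, q` collapses to `x, q` while the other becomes `x, p,
    -- q`: an insertion turns into an erasure.
    by_cases hcx : x = c
    · subst hcx
      have hm : M x p := hcb.resolve_left (lt_asymm hxp)
      simpa [DiscreteFlow.pushWalk, hne, hcq] using
        WalkDiff.eraseUpper [] l₂ hm (hqx.trans hxp) hqx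
    · simpa [DiscreteFlow.pushWalk, hne, hcq, hcx] using WalkDiff.insert [c] l₂ hxp hqx
  | @eraseUpper l₁ l₂ p x q hpx hqx hqp =>
    refine pushWalk_append l₁ (fun l => .eraseUpper l l₂ hpx hqx hqp) ?_ hb hne
    rintro rfl
    have hcq : q ≠ c := by
      rintro rfl
      rcases hcb with h | h
      · exact lt_asymm h hqp
      · exact hM.not_chain h hpx
    by_cases hcx : x = c
    · subst hcx
      simpa [DiscreteFlow.pushWalk, hne, hcq] using WalkDiff.insert [] l₂ (hM.lt hpx) hqp
    · simpa [DiscreteFlow.pushWalk, hne, hcq, hcx] using WalkDiff.eraseUpper [c] l₂ hpx hqx hqp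
  | @eraseLower l₁ l₂ p x q hxp hxq hqp =>
    refine pushWalk_append l₁ (fun l => .eraseLower l l₂ hxp hxq hqp) ?_ hb hne
    rintro rfl
    have hcq : q ≠ c := by
      rintro rfl
      rcases hcb with h | h
      · exact lt_asymm h hqp
      · exact hM.not_chain hxq h
    have hcx : x ≠ c := by
      rintro rfl
      rcases hcb with h | h
      · exact lt_asymm h hxp
      · exact hqp.ne (hM.right_unique hxq h)
    simpa [DiscreteFlow.pushWalk, hne, hcq, hcx] using WalkDiff.eraseLower [c] l₂ hxp hxq hqp

theorem OneStep.walkDiff {x z : Ent P} {γ' γ : LocHom S x z} (H : OneStep hM γ' γ) :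
    WalkDiff M (nf hM γ') (nf hM γ) := by
  induction H with
  | @remove p x q hxp hqx δ =>
    rw [nf_pre_step, nf_pre_step, nf_pre_step]
    have W := isWalk_nf (hM := hM) δ
    have hh := W.head?_eq
    have hc := W.isChain
    have hr := isReduced_nf hM δ
    generalize nf hM δ = s at hh hc hr
    obtain ⟨l, rfl⟩ : ∃ l, s = q :: l := by
      cases s with
      | nil => simp at hh
      | cons a l => exact ⟨l, by simpa using hh⟩
    have hqp := hqx.trans hxp
    cases l with
    | nil => simpa [pushWalk, hqx.ne', hqp.ne', hxp.ne', hqp.ne] using WalkDiff.insert [] [] hxp hqx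
    | cons c l =>
      rw [List.isChain_cons_cons] at hc
      have hcp : c ≠ p := by
        rintro rfl
        rcases hc.1 with h | h
        · exact lt_asymm h hqp
        · exact hM.not_lt h hqx hxp
      -- If the walk continues from `q` up to `x`, the inserted descent from `x` to `q` cancels
      -- against it, and the finer sequence gets the shorter reduced walk.
      by_cases hcx : c = x
      · subst hcx
        have hm : M q c := hc.1.resolve_left (lt_asymm hqx)
        have hl : l.head? ≠ some p := by
          intro hl
          obtain ⟨l', rfl⟩ : ∃ l', l = p :: l' := by
            cases l with
            | nil => simp at hl
            | cons a l => exact ⟨l, by simpa using hl⟩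
          rcases (List.isChain_cons_cons.1 hc.2).1 with h | h
          · exact lt_asymm h hxp
          · exact hM.not_chain hm h
        simpa [pushWalk, hqx.ne', hqp.ne', hxp.ne', hcp, hl] using
          WalkDiff.eraseLower [] l hqp hm hxp
      · simpa [pushWalk, hqx.ne', hqp.ne', hxp.ne', hcp, hcx, hqp.ne] using
          WalkDiff.insert [] (c :: l) hxp hqx
  | pre h H ih =>
    rw [nf_pre_step, nf_pre_step]
    exact ih.pushWalk hM (isWalk_nf (hM := hM) _).head?_eq (Or.inl h)
  | back h hm H ih =>
    rw [nf_back, nf_back]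
    exact ih.pushWalk hM (isWalk_nf (hM := hM) _).head?_eq (Or.inr hm)

theorem WalkDiff.addsOne {s t : List (Ent P)} (h : WalkDiff M s t) :
    AddsOne s t ∨ AddsOne t s := by
  cases h with
  | @insert l₁ l₂ p x q _ _ => exact Or.inl ⟨l₁ ++ [p], q :: l₂, x, by simp, by simp⟩
  | @eraseUpper l₁ l₂ p x q _ _ _ => exact Or.inr ⟨l₁ ++ [p], q :: l₂, x, by simp, by simp⟩
  | @eraseLower l₁ l₂ p x q _ _ _ => exact Or.inr ⟨l₁ ++ [p], q :: l₂, x, by simp, by simp⟩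

/-- Two walks that differ in one inner vertex and represent morphisms of adjacent ranks are
comparable. -/
theorem IsWalk.le_of_insert {z : Ent P} (p x q : Ent P) (l₂ : List (Ent P)) :
    ∀ (l₁ : List (Ent P)) {y : Ent P} {γ δ : LocHom S y z},
      IsWalk hM (l₁ ++ p :: x :: q :: l₂) γ → IsWalk hM (l₁ ++ p :: q :: l₂) δ →
      (γ.rankSum = δ.rankSum + 1 → γ ≤ δ) ∧ (δ.rankSum = γ.rankSum + 1 → δ ≤ γ) := by
  intro l₁
  induction l₁ with
  | nil =>
    intro y γ δ W W'
    have hle : ∀ {a b c : Ent P} (h : b < a) (h' : c < b),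
        Ent.step (h'.trans h) ≤ Ent.step h ≫ Ent.step h' := fun h h' =>
      Ent.le_iff.2 (by simp [Ent.tail_comp, Ent.tail_step])
    cases W with
    | @down _ _ _ γ₁ hxp W₁ =>
      cases W₁ with
      | @down _ _ _ γ₂ hqx W₂ =>
        cases W' with
        | @down _ _ _ δ₂ hqp W₃ =>
          obtain rfl := W₂.unique W₃
          simp only [rankSum_pre, Ent.r_step]
          refine ⟨fun h => by omega, fun _ => ?_⟩
          rw [← pre_comp]
          exact pre_mono (hle hxp hqx) (LocHom.le_refl _)
        | up hpq hm W₃ => exact absurd hpq (lt_asymm (hqx.trans hxp))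
      | @up _ _ _ γ₂ hxq hm W₂ =>
        cases W' with
        | @down _ _ _ δ₂ hqp W₃ =>
          obtain rfl := W₂.unique W₃
          simp only [rankSum_pre, rankSum_back, Ent.r_step]
          refine ⟨fun _ => ?_, fun h => by omega⟩
          -- Inserting `q > x` and its inverse makes both sides begin with a path from `p` to `x`,
          -- so `p > x` is compared with `p > q > x`.
          conv_rhs => rw [← pre_back (Ent.step hxq) (hM.plus_step hxq hm) γ₂]
          rw [← pre_comp]
          exact pre_mono (hle hqp hxq) (LocHom.le_refl _)
        | up hpq hm' W₃ => exact absurd (hM.left_unique hm hm') hxp.ne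
    | @up _ _ _ γ₁ hpx hm W₁ =>
      cases W₁ with
      | @down _ _ _ γ₂ hqx W₂ =>
        cases W' with
        | @down _ _ _ δ₂ hqp W₃ =>
          obtain rfl := W₂.unique W₃
          simp only [rankSum_pre, rankSum_back, Ent.r_step]
          refine ⟨fun _ => ?_, fun h => by omega⟩
          conv_rhs => rw [← back_pre (Ent.step hpx) (hM.plus_step hpx hm) (pre _ γ₂)]
          rw [← pre_comp]
          exact back_mono _ _ (pre_mono (hle hpx hqp) (LocHom.le_refl _))
        | up hpq hm' W₃ => exact absurd (hM.right_unique hm hm').symm hqx.ne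
      | up hxq hm' W₂ => exact absurd hm' (hM.not_chain hm)
  | cons e l₁ ih =>
    intro y γ δ W W'
    obtain ⟨b, m, h1⟩ : ∃ b m, l₁ ++ p :: x :: q :: l₂ = b :: m := by
      cases l₁ <;> exact ⟨_, _, rfl⟩
    obtain ⟨m', h2⟩ : ∃ m', l₁ ++ p :: q :: l₂ = b :: m' := by
      cases l₁ <;> (cases h1; exact ⟨_, rfl⟩)
    rw [List.cons_append, h1] at W
    rw [List.cons_append, h2] at W'
    rw [h1, h2] at ih
    cases W with
    | @down _ _ _ γ₁ h W =>
      cases W' with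
      | @down _ _ _ δ₁ h' W' =>
        obtain ⟨i1, i2⟩ := ih W W'
        simp only [rankSum_pre]
        exact ⟨fun e => pre_mono le_rfl (i1 (by omega)), fun e => pre_mono le_rfl (i2 (by omega))⟩
      | up h' hm W' => exact absurd h (lt_asymm h')
    | @up _ _ _ γ₁ h hm W =>
      cases W' with
      | down h' W' => exact absurd h (lt_asymm h')
      | @up _ _ _ δ₁ h' hm W' =>
        obtain ⟨i1, i2⟩ := ih W W'
        simp only [rankSum_back]
        exact ⟨fun e => back_mono _ _ (i1 (by omega)), fun e => back_mono _ _ (i2 (by omega))⟩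

/-- Both walks have the same endpoints, so a cell added at either end would occur twice in `t`. The
extra cell is therefore an inner one. -/
theorem IsWalk.le_of_addsOne {y z : Ent P} {s t : List (Ent P)} {γ δ : LocHom S y z}
    (W : IsWalk hM t γ) (W' : IsWalk hM s δ) (ht : t.Nodup) (h : AddsOne s t) :
    (γ.rankSum = δ.rankSum + 1 → γ ≤ δ) ∧ (δ.rankSum = γ.rankSum + 1 → δ ≤ γ) := by
  obtain ⟨a, b, x, rfl, rfl⟩ := h
  rcases List.eq_nil_or_concat a with rfl | ⟨a, p, rfl⟩
  · exfalso
    have h1 := W.head?_eq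
    have h2 := W'.head?_eq
    simp only [List.nil_append, List.head?_cons, Option.some.injEq] at h1 h2
    subst h1
    exact (List.nodup_cons.1 ht).1 (List.mem_of_mem_head? h2)
  cases b with
  | nil =>
    exfalso
    have h1 := W.getLast?_eq
    have h2 := W'.getLast?_eq
    simp only [List.getLast?_append, List.getLast?_singleton, Option.some_or,
      Option.some.injEq] at h1
    subst h1
    rw [List.nodup_append] at ht
    exact ht.2.2 _ (List.mem_of_mem_getLast? (by simpa using h2)) _ (by simp) rfl
  | cons q b =>
    rw [List.concat_eq_append, List.append_assoc] at W W'
    exact IsWalk.le_of_insert p x q b a W W'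

end Order

end Potential

/-! ### Application to discrete Morse functions -/

section Morse

variable {X : Type u} [TopologicalSpace X] {K : Set X} [Topology.CWComplex K] {f : Cell K → ℝ}

theorem IsRegularPair.dim_eq {x y : Cell K} (h : IsRegularPair f x y) : y.dim = x.dim + 1 := h.1

theorem Cell.dim_lt_of_lt {x y : Cell K} (h : x < y) : x.dim < y.dim :=
  Cell.dim_lt_of_closed_subset h.le h.ne

theorem IsRegularPair.lt {x y : Cell K} (h : IsRegularPair f x y) : x < y :=
  lt_of_le_of_ne h.2.1 fun e => by
    have := h.dim_eq
    rw [e] at this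
    omega

/-- A cell is not at the same time the upper cell of a regular pair and the lower cell of
another one. -/
theorem IsDiscreteMorse.not_chain [T2Space X] (hK : IsRegularCW K) (hf : IsDiscreteMorse f)
    {v x y : Cell K} (h₁ : IsRegularPair f v x) (h₂ : IsRegularPair f x y) : False := by
  -- The second cell `x'` is paired with neither `v` nor `y`, whence `f v < f x' < f y ≤ f x ≤ f v`.
  obtain ⟨x', hne, hd, hv, hy⟩ := hK.exists_ne_between h₁.1 h₂.1 h₁.2.1 h₂.2.1
  have hd1 := h₁.dim_eq
  have hd2 := h₂.dim_eq
  have h3 : f v < f x' := by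
    by_contra h
    exact hne ((hf v).1 ⟨by omega, hv, not_lt.1 h⟩ h₁)
  have h4 : f x' < f y := by
    by_contra h
    exact hne ((hf y).2 ⟨by omega, hy, not_lt.1 h⟩ h₂)
  linarith [h₁.2.2, h₂.2.2]

theorem IsDiscreteMorse.isCoverMatching [T2Space X] (hK : IsRegularCW K)
    (hf : IsDiscreteMorse f) :
    IsCoverMatching (morseSystem f) (fun a b : Ent (Cell K) => IsRegularPair f a b) where
  mem_iff {x y} g := by
    refine and_congr_right fun _ => ⟨fun h => (List.cons.inj h).2, fun h => ?_⟩
    exact congrArg (List.cons (α := Cell K) y) h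
  lt h := h.lt
  not_lt {a b c} h hac hcb := by
    have h1 := Cell.dim_lt_of_lt hac
    have h2 := Cell.dim_lt_of_lt hcb
    have h3 := h.dim_eq
    omega
  right_unique {a b c} h h' := (hf a).1 h h'
  left_unique {a b c} h h' := (hf c).2 h h'
  not_chain h h' := hf.not_chain hK h h'

open Classical in
/-- The lower cell of the regular pair of a cell, or the cell itself. -/
noncomputable def lowerCell (f : Cell K → ℝ) (x : Cell K) : Cell K :=
  if h : ∃ v, IsRegularPair f v x then h.choose else x

theorem lowerCell_eq_of_isRegularPair (hf : IsDiscreteMorse f) {v x : Cell K}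
    (h : IsRegularPair f v x) : lowerCell f x = v := by
  have hx : ∃ v, IsRegularPair f v x := ⟨v, h⟩
  rw [lowerCell, dif_pos hx]
  exact (hf x).2 hx.choose_spec h

theorem lowerCell_eq_self {x : Cell K} (h : ¬ ∃ v, IsRegularPair f v x) : lowerCell f x = x :=
  dif_neg h

/-- The dimension of the lower cell drops on an unmatched descent, except possibly from the upper
cell `a` of a pair `{v, a}` to another facet `b`. There `f b < f a ≤ f v` breaks the tie. -/
theorem IsDiscreteMorse.isPotential [T2Space X] (hK : IsRegularCW K) (hf : IsDiscreteMorse f) :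
    IsPotential (fun a b : Ent (Cell K) => IsRegularPair f a b)
      (fun x : Ent (Cell K) => toLex ((lowerCell f x).dim, f (lowerCell f x))) where
  eq {a b} h := by
    have h1 : lowerCell f b = a := lowerCell_eq_of_isRegularPair hf h
    have h2 : lowerCell f a = a := lowerCell_eq_self fun ⟨v, hv⟩ => hf.not_chain hK hv h
    rw [h1, h2]
  lt {a b} hba hm := by
    have hd : Cell.dim b < Cell.dim a := Cell.dim_lt_of_lt hba
    rw [Prod.Lex.toLex_lt_toLex]
    by_cases ha : ∃ v, IsRegularPair f v a
    · obtain ⟨v, hv⟩ := ha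
      have h1 : lowerCell f a = v := lowerCell_eq_of_isRegularPair hf hv
      have hdv := hv.dim_eq
      rw [h1]
      by_cases hb : ∃ u, IsRegularPair f u b
      · obtain ⟨u, hu⟩ := hb
        have h2 : lowerCell f b = u := lowerCell_eq_of_isRegularPair hf hu
        have := hu.dim_eq
        rw [h2]
        left
        change u.dim < v.dim
        omega
      · rw [lowerCell_eq_self hb]
        rcases (show Cell.dim b ≤ v.dim by omega).lt_or_eq with h | h
        · exact Or.inl h
        · refine Or.inr ⟨h, ?_⟩
          have hlt : f a > f b := by
            by_contra hle
            exact hm ⟨by omega, hba.le, not_lt.1 hle⟩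
          exact lt_of_lt_of_le hlt hv.2.2
    · rw [lowerCell_eq_self ha]
      left
      by_cases hb : ∃ u, IsRegularPair f u b
      · obtain ⟨u, hu⟩ := hb
        have h2 : lowerCell f b = u := lowerCell_eq_of_isRegularPair hf hu
        have := hu.dim_eq
        rw [h2]
        change u.dim < Cell.dim a
        omega
      · rw [lowerCell_eq_self hb]
        exact hd

/-- The sequence representation of a morphism of the flow category is its reduced walk. -/
theorem isSeqRep_iff [T2Space X] (hK : IsRegularCW K) (hf : IsDiscreteMorse f)
    {w z : CriticalCell f} (γ : FlowHom f w z) (s : List (Cell K)) :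
    IsSeqRep γ s ↔ s = LocHom.nf (hf.isCoverMatching hK) γ := by
  constructor
  · rintro ⟨hn, -, -, -, ζ, rfl, rfl⟩
    exact (reduceWalk_eq_self (isReduced_of_nodup hn)).symm
  · rintro rfl
    have W := LocHom.isWalk_nf (hM := hf.isCoverMatching hK) γ
    refine ⟨(hf.isPotential hK).nodup (hf.isCoverMatching hK) W.isChain
      (LocHom.isReduced_nf _ γ), W.head?_eq, W.getLast?_eq, ?_, W.exists_zigzag⟩
    exact W.isChain.imp fun a b h => h.imp id Or.inl

theorem rho_toAug {w z : CriticalCell f} (γ : FlowHom f w z) :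
    rho (toAug γ) = ((w.1.dim : ℤ) - (z.1.dim : ℤ)) + γ.rankSum := rfl

theorem toAug_lt_toAug {w z : CriticalCell f} {γ τ : FlowHom f w z} :
    toAug γ < toAug τ ↔ τ ≤ γ ∧ τ ≠ γ :=
  WithBot.coe_lt_coe

/-- The rank is integral and strictly monotone on morphisms, so nothing fits between comparable
elements of adjacent ranks. -/
theorem toAug_covBy_iff [T2Space X] (hK : IsRegularCW K) (hf : IsDiscreteMorse f)
    {w z : CriticalCell f} {γ τ : FlowHom f w z} (h : τ.rankSum = γ.rankSum + 1) :
    toAug γ ⋖ toAug τ ↔ τ ≤ γ := by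
  have hlt : ∀ {γ τ : FlowHom f w z}, toAug γ < toAug τ → γ.rankSum < τ.rankSum := by
    intro γ τ h
    rw [toAug_lt_toAug] at h
    obtain ⟨h1, h2, -⟩ := LocHom.rankSum_le_of_le (hf.isCoverMatching hK) h.1
    exact lt_of_le_of_ne h1 fun e => h.2 (h2 e.symm)
  refine ⟨fun hc => (toAug_lt_toAug.1 hc.1).1, fun hle => ⟨toAug_lt_toAug.2 ⟨hle, ?_⟩, ?_⟩⟩
  · rintro rfl
    omega
  · intro c h1 h2
    induction c using WithBot.recBotCoe with
    | bot => exact WithBot.not_lt_bot _ h1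
    | coe c =>
      have h3 := hlt (τ := OrderDual.ofDual c) h1
      have h4 := hlt (γ := OrderDual.ofDual c) h2
      omega

end Morse

end DiscreteFlow

theorem mainTheorem9 {X : Type u} [TopologicalSpace X] [T2Space X] (K : Set X)
    [Topology.CWComplex K] [Topology.RelCWComplex.Finite K] (hK : DiscreteFlow.IsRegularCW K)
    (f : DiscreteFlow.Cell K → ℝ) (hf : DiscreteFlow.IsDiscreteMorse f)
    (w z : DiscreteFlow.CriticalCell f) :
    (∀ α : DiscreteFlow.FlowHom f w z, ∃! s : List (DiscreteFlow.Cell K),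
      DiscreteFlow.IsSeqRep α s) ∧
    ∀ γ τ : DiscreteFlow.FlowHom f w z,
      DiscreteFlow.rho (DiscreteFlow.toAug τ) = DiscreteFlow.rho (DiscreteFlow.toAug γ) + 1 →
      ∀ sγ sτ : List (DiscreteFlow.Cell K),
        DiscreteFlow.IsSeqRep γ sγ → DiscreteFlow.IsSeqRep τ sτ →
        (DiscreteFlow.toAug γ ⋖ DiscreteFlow.toAug τ ↔
          DiscreteFlow.AddsOne sτ sγ ∨ DiscreteFlow.AddsOne sγ sτ) := by
  open DiscreteFlow in
  have hM := hf.isCoverMatching hK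
  refine ⟨fun α => ⟨LocHom.nf hM α, (isSeqRep_iff hK hf α _).2 rfl,
    fun s hs => (isSeqRep_iff hK hf α s).1 hs⟩, ?_⟩
  intro γ τ hρ sγ sτ hsγ hsτ
  have hr : τ.rankSum = γ.rankSum + 1 := by
    rw [rho_toAug, rho_toAug] at hρ
    omega
  rw [toAug_covBy_iff hK hf hr]
  have hnγ := hsγ.1
  have hnτ := hsτ.1
  rw [isSeqRep_iff hK hf] at hsγ hsτ
  subst hsγ hsτ
  have Wγ := LocHom.isWalk_nf (hM := hM) γ
  have Wτ := LocHom.isWalk_nf (hM := hM) τ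
  constructor
  · intro h
    exact ((LocHom.rankSum_le_of_le hM h).2.2 hr).walkDiff.addsOne
  · rintro (h | h)
    · exact (Wγ.le_of_addsOne Wτ hnγ h).2 hr
    · exact (Wτ.le_of_addsOne Wγ hnτ h).1 hr
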